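/- Let $p,q\ge 0$, let $M$ be a smooth manifold, and let $\mathcal T\to M$ be a fake tangent bundle: a smooth vector bundle isomorphic to $TM$, equipped with a smooth metric of signature $(p,q)$. Let $\mathcal F\to M$ be its fake frame bundle, the principal $\mathrm O(p,q)$-bundle whose fibre over $x$ consists of the linear isometries $\mathbb R^{p,q}\to\mathcal T_x$. Let $\mathbf{Tel}(p,q)$ be the teleparallel 2-group: its group of objects is $\mathrm{IO}(p,q)=\mathrm O(p,q)\ltimes\mathbb R^{p,q}$, its group of morphisms is $\mathrm{IO}(p,q)\ltimes\mathbb R^{p,q}$, the morphism $((g,v),w)$ has source $(g,v)$ and target $(g,v+w)$, and $((g,v),w)\circ((g',v'),w')=((g',v'),w+w')$. Its crossed module is given by $t(v)=(1,v)$ and $\alpha(g,v)w=gw$, with infinitesimal version $\underline t(v)=(0,v)$. Let $\mathcal F\times_{\mathrm O(p,q)}\mathbf{Tel}(p,q)$ be the associated principal $\mathbf{Tel}(p,q)$ 2-bundle, with local trivializations over open sets $U_i$ covering $M$ and transition functions $g_{ij}\colon U_i\cap U_j\to\mathrm{IO}(p,q)$. A (strict) 2-connection on it consists of smooth $\mathfrak{io}(p,q)$-valued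 1-forms $A_i$ and $\mathbb R^{p,q}$-valued 2-forms $B_i$ on the $U_i$ satisfying the fake flatness condition $dA_i+A_i\wedge A_i=\underline t(B_i)$, and on $U_i\cap U_j$ $$A_i=g_{ij}A_jg_{ij}^{-1}+g_{ij}\,dg_{ij}^{-1},\qquad B_i=\alpha(g_{ij})(B_j).$$ The forms $A_i$ describe a connection on the bundle of objects $\mathcal F\times_{\mathrm O(p,q)}\mathrm{IO}(p,q)$, and the forms $B_i$ describe a $\mathcal T$-valued 2-form $\tau$ (the 2-form part). For a connection $\omega$ on $\mathcal F$, with induced covariant derivative $D$ on $\mathcal T$, and a $\mathcal T$-valued 1-form $e$, the torsion is the $\mathcal T$-valued 2-form $$(d_\omega e)(X,Y)=D_X(e(Y))-D_Y(e(X))-e([X,Y]).$$ **Theorem.** A 2-connection on $\mathcal F\times_{\mathrm O(p,q)}\mathbf{Tel}(p,q)$ consists of a flat connection $\omega$ on $\mathcal F$, a $\mathcal T$-valued 1-form $e$, and the $\mathcal T$-valued 2-form $d_\omega e$. Precisely: 1. For every connection $\omega$ on $\mathcal F$ and every $\mathcal T$-valued 1-form $e$, the formula above defines exactly one $\mathcal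 T$-valued 2-form $d_\omega e$. 2. For every 2-connection there are a unique connection $\omega$ on $\mathcal F$, a unique $\mathcal T$-valued 1-form $e$ and a unique $\mathcal T$-valued 2-form $\tau$ such that its 2-form part is $\tau$ and its 1-form part, pulled back to $\mathcal F$ and decomposed according to $\mathfrak{io}(p,q)=\mathfrak o(p,q)\oplus\mathbb R^{p,q}$, is $\omega+e$ (where $e$ is viewed as the $\mathbb R^{p,q}$-valued form $f^{-1}\circ e$ at a frame $f$). 3. For this $\omega$, $e$, $\tau$, the curvature $R=d\omega+\omega\wedge\omega$ vanishes and $\tau=d_\omega e$. 4. Conversely, for every flat connection $\omega$ on $\mathcal F$ and every $\mathcal T$-valued 1-form $e$ there is exactly one 2-connection with 1-form part $\omega+e$ and 2-form part $d_\omega e$. -/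

import Mathlib

open Bundle TopologicalSpace
open scoped Manifold ContDiff Topology

noncomputable section

namespace Teleparallel

/-! ## The groups `O(p,q)` and `IO(p,q)` -/

/-- The vector space underlying `ℝ^{p,q}`. -/
abbrev Rpq (p q : ℕ) : Type := Fin p ⊕ Fin q → ℝ

/-- The metric `dx₁² + ⋯ + dx_p² - dx_{p+1}² - ⋯ - dx_{p+q}²` of `ℝ^{p,q}`. -/
def stdMetric {p q : ℕ} (v w : Rpq p q) : ℝ :=
  ∑ i : Fin p, v (Sum.inl i) * w (Sum.inl i) - ∑ j : Fin q, v (Sum.inr j) * w (Sum.inr j)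

/-- The linear endomorphisms of `ℝ^{p,q}`. -/
abbrev EndR (p q : ℕ) : Type := Rpq p q →L[ℝ] Rpq p q

/-- The Lorentz group `O(p,q)` of linear isometries of `ℝ^{p,q}`. -/
def lorentz (p q : ℕ) : Subgroup (Rpq p q ≃L[ℝ] Rpq p q) where
  carrier := {g | ∀ v w, stdMetric (g v) (g w) = stdMetric v w}
  mul_mem' {a b} ha hb v w := by
    change stdMetric (a (b v)) (a (b w)) = _
    rw [ha, hb]
  one_mem' _ _ := rfl
  inv_mem' {a} ha v w := by
    have h := ha (a⁻¹ v) (a⁻¹ w)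
    have e : ∀ u, a (a⁻¹ u) = u := fun u => a.apply_symm_apply u
    rw [e, e] at h
    exact h.symm

/-- The Lorentz group `O(p,q)`, as a type. -/
abbrev Opq (p q : ℕ) : Type := lorentz p q

/-- An element of `O(p,q)` as a linear map. -/
def Opq.toEnd {p q : ℕ} (g : Opq p q) : EndR p q := ((g : Rpq p q ≃L[ℝ] Rpq p q) : EndR p q)

@[simp] theorem Opq.toEnd_mul {p q : ℕ} (g h : Opq p q) (v : Rpq p q) :
    (g * h).toEnd v = g.toEnd (h.toEnd v) := rfl

@[simp] theorem Opq.toEnd_one {p q : ℕ} (v : Rpq p q) : (1 : Opq p q).toEnd v = v := rfl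

@[simp] theorem Opq.toEnd_inv_apply {p q : ℕ} (g : Opq p q) (v : Rpq p q) :
    g⁻¹.toEnd (g.toEnd v) = v := by
  rw [← Opq.toEnd_mul, inv_mul_cancel, Opq.toEnd_one]

@[simp] theorem Opq.toEnd_apply_inv {p q : ℕ} (g : Opq p q) (v : Rpq p q) :
    g.toEnd (g⁻¹.toEnd v) = v := by
  rw [← Opq.toEnd_mul, mul_inv_cancel, Opq.toEnd_one]

/-- The Lie algebra `𝔬(p,q)` of `O(p,q)`. -/
def opq (p q : ℕ) : Submodule ℝ (EndR p q) where
  carrier := {X | ∀ v w, stdMetric (X v) w + stdMetric v (X w) = 0}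
  add_mem' {a b} ha hb v w := by
    have h1 := ha v w
    have h2 := hb v w
    simp only [stdMetric, add_apply, Pi.add_apply, add_mul, mul_add,
      Finset.sum_add_distrib] at h1 h2 ⊢
    linarith
  zero_mem' v w := by simp [stdMetric]
  smul_mem' c a ha v w := by
    have h1 := ha v w
    have e1 : stdMetric ((c • a) v) w = c * stdMetric (a v) w := by
      simp [stdMetric, mul_sub, Finset.mul_sum, mul_assoc]
    have e2 : stdMetric v ((c • a) w) = c * stdMetric v (a w) := by
      simp [stdMetric, mul_sub, Finset.mul_sum, mul_left_comm]
    rw [e1, e2, ← mul_add, h1, mul_zero]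

/-- The Poincaré group `IO(p,q) = O(p,q) ⋉ ℝ^{p,q}`. -/
@[ext] structure IOpq (p q : ℕ) where
  /-- the Lorentz part `g` of `(g, h)` -/
  rot : Opq p q
  /-- the translation part `h` of `(g, h)` -/
  trans : Rpq p q

instance (p q : ℕ) : Group (IOpq p q) where
  mul a b := ⟨a.rot * b.rot, a.trans + a.rot.toEnd b.trans⟩
  one := ⟨1, 0⟩
  inv a := ⟨a.rot⁻¹, -(a.rot⁻¹.toEnd a.trans)⟩
  mul_assoc a b c := by
    refine IOpq.ext (mul_assoc _ _ _) ?_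
    change (a.trans + a.rot.toEnd b.trans) + (a.rot * b.rot).toEnd c.trans
      = a.trans + a.rot.toEnd (b.trans + b.rot.toEnd c.trans)
    simp [add_assoc]
  one_mul a := by
    refine IOpq.ext (one_mul _) ?_
    change (0 : Rpq p q) + (1 : Opq p q).toEnd a.trans = a.trans
    simp
  mul_one a := by
    refine IOpq.ext (mul_one _) ?_
    change a.trans + a.rot.toEnd 0 = a.trans
    simp
  inv_mul_cancel a := by
    refine IOpq.ext (inv_mul_cancel _) ?_
    change -(a.rot⁻¹.toEnd a.trans) + a.rot⁻¹.toEnd a.trans = 0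
    simp

@[simp] theorem IOpq.mul_rot {p q : ℕ} (a b : IOpq p q) : (a * b).rot = a.rot * b.rot := rfl
@[simp] theorem IOpq.mul_trans {p q : ℕ} (a b : IOpq p q) :
    (a * b).trans = a.trans + a.rot.toEnd b.trans := rfl
@[simp] theorem IOpq.one_rot {p q : ℕ} : (1 : IOpq p q).rot = 1 := rfl
@[simp] theorem IOpq.one_trans {p q : ℕ} : (1 : IOpq p q).trans = 0 := rfl
@[simp] theorem IOpq.inv_rot {p q : ℕ} (a : IOpq p q) : a⁻¹.rot = a.rot⁻¹ := rfl
@[simp] theorem IOpq.inv_trans {p q : ℕ} (a : IOpq p q) :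
    a⁻¹.trans = -(a.rot⁻¹.toEnd a.trans) := rfl

/-- The inclusion `O(p,q) → IO(p,q)`. -/
def IOpq.ofO (p q : ℕ) : Opq p q →* IOpq p q where
  toFun g := ⟨g, 0⟩
  map_one' := rfl
  map_mul' g h := IOpq.ext rfl (by simp)

/-- The matrix algebra in which `IO(p,q)` and its Lie algebra live: the endomorphisms of
`ℝ^{p,q} ⊕ ℝ`, i.e. the matrices of size `p + q + 1`. -/
abbrev Aff (p q : ℕ) : Type := (Rpq p q × ℝ) →L[ℝ] (Rpq p q × ℝ)

/-- The block matrix with first row `(ξ, u)` and second row `(0, c)`. -/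
def affMk {p q : ℕ} (ξ : EndR p q) (u : Rpq p q) (c : ℝ) : Aff p q :=
  (ξ.coprod ((ContinuousLinearMap.id ℝ ℝ).smulRight u)).prod
    (c • ContinuousLinearMap.snd ℝ (Rpq p q) ℝ)

@[simp] theorem affMk_apply {p q : ℕ} (ξ : EndR p q) (u : Rpq p q) (c : ℝ) (v : Rpq p q × ℝ) :
    affMk ξ u c v = (ξ v.1 + v.2 • u, c * v.2) := by
  simp [affMk]

/-- The standard faithful representation of `IO(p,q)` by affine matrices. -/
def IOpq.mat {p q : ℕ} (a : IOpq p q) : Aff p q := affMk a.rot.toEnd a.trans 1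

theorem IOpq.mat_mul {p q : ℕ} (a b : IOpq p q) : (a * b).mat = a.mat * b.mat := by
  refine ContinuousLinearMap.ext fun v => ?_
  rw [mul_apply_eq_comp]
  simp only [IOpq.mat, affMk_apply, IOpq.mul_rot, IOpq.mul_trans, Opq.toEnd_mul, map_add, map_smul,
    smul_add, one_mul]
  congr 1
  abel

theorem IOpq.mat_one {p q : ℕ} : (1 : IOpq p q).mat = 1 := by
  refine ContinuousLinearMap.ext fun v => ?_
  simp [IOpq.mat]

/-- The element `(ξ, u)` of `𝔦𝔬(p,q) = 𝔬(p,q) ⊕ ℝ^{p,q}` as a matrix. -/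
def ioMk {p q : ℕ} (ξ : EndR p q) (u : Rpq p q) : Aff p q := affMk ξ u 0

/-- The Lie algebra `𝔦𝔬(p,q)` of `IO(p,q)`; its bracket is the commutator of matrices. -/
def io (p q : ℕ) : Set (Aff p q) := {X | ∃ ξ ∈ opq p q, ∃ u, X = ioMk ξ u}

theorem ioMk_bracket {p q : ℕ} (ξ ξ' : EndR p q) (u u' : Rpq p q) :
    ⁅ioMk ξ u, ioMk ξ' u'⁆ = ioMk ⁅ξ, ξ'⁆ (ξ u' - ξ' u) := by
  refine ContinuousLinearMap.ext fun v => ?_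
  rw [LieRing.of_associative_ring_bracket, LieRing.of_associative_ring_bracket]
  simp only [sub_apply, mul_apply_eq_comp, ioMk, affMk_apply, map_add, map_smul,
    zero_mul, zero_smul, add_zero, Prod.mk_sub_mk, sub_self, smul_sub]
  congr 1
  abel

/-! ## The teleparallel 2-group -/

/-- The group `IO(p,q) ⋉ ℝ^{p,q}` of morphisms of `Tel(p,q)`; the group of objects is
`IO(p,q)`. -/
@[ext] structure TelMor (p q : ℕ) where
  /-- the component `(g, v)` of `((g, v), w)` -/
  base : IOpq p q
  /-- the component `w` of `((g, v), w)` -/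
  shift : Rpq p q

instance (p q : ℕ) : Group (TelMor p q) where
  mul m n := ⟨m.base * n.base, m.shift + m.base.rot.toEnd n.shift⟩
  one := ⟨1, 0⟩
  inv m := ⟨m.base⁻¹, -(m.base.rot⁻¹.toEnd m.shift)⟩
  mul_assoc a b c := by
    refine TelMor.ext (mul_assoc _ _ _) ?_
    change (a.shift + a.base.rot.toEnd b.shift) + (a.base.rot * b.base.rot).toEnd c.shift
      = a.shift + a.base.rot.toEnd (b.shift + b.base.rot.toEnd c.shift)
    simp [add_assoc]
  one_mul a := by
    refine TelMor.ext (one_mul _) ?_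
    change (0 : Rpq p q) + (1 : Opq p q).toEnd a.shift = a.shift
    simp
  mul_one a := by
    refine TelMor.ext (mul_one _) ?_
    change a.shift + a.base.rot.toEnd 0 = a.shift
    simp
  inv_mul_cancel a := by
    refine TelMor.ext (inv_mul_cancel _) ?_
    change -(a.base.rot⁻¹.toEnd a.shift) + a.base.rot⁻¹.toEnd a.shift = 0
    simp

@[simp] theorem TelMor.mul_base {p q : ℕ} (m n : TelMor p q) :
    (m * n).base = m.base * n.base := rfl
@[simp] theorem TelMor.mul_shift {p q : ℕ} (m n : TelMor p q) :
    (m * n).shift = m.shift + m.base.rot.toEnd n.shift := rfl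
@[simp] theorem TelMor.inv_base {p q : ℕ} (m : TelMor p q) : m⁻¹.base = m.base⁻¹ := rfl
@[simp] theorem TelMor.inv_shift {p q : ℕ} (m : TelMor p q) :
    m⁻¹.shift = -(m.base.rot⁻¹.toEnd m.shift) := rfl

/-- The source `(g, v)` of `((g, v), w)`. -/
def TelMor.source (p q : ℕ) : TelMor p q →* IOpq p q where
  toFun m := m.base
  map_one' := rfl
  map_mul' _ _ := rfl

/-- The target `(g, v + w)` of `((g, v), w)`. -/
def TelMor.target (p q : ℕ) : TelMor p q →* IOpq p q where
  toFun m := ⟨m.base.rot, m.base.trans + m.shift⟩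
  map_one' := IOpq.ext rfl (add_zero 0)
  map_mul' m n := IOpq.ext rfl (by
    simp only [TelMor.mul_base, TelMor.mul_shift, IOpq.mul_trans, map_add]
    abel)

/-- The identity morphism `((g, v), 0)` of `(g, v)`. -/
def TelMor.ident (p q : ℕ) : IOpq p q →* TelMor p q where
  toFun a := ⟨a, 0⟩
  map_one' := rfl
  map_mul' a b := TelMor.ext rfl (by simp)

/-- The composite `m ∘ n`; it is meant for `source m = target n`. -/
def TelMor.comp {p q : ℕ} (m n : TelMor p q) : TelMor p q := ⟨n.base, m.shift + n.shift⟩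

theorem TelMor.source_comp {p q : ℕ} (m n : TelMor p q) :
    TelMor.source p q (m.comp n) = TelMor.source p q n := rfl

theorem TelMor.target_comp {p q : ℕ} (m n : TelMor p q)
    (h : TelMor.source p q m = TelMor.target p q n) :
    TelMor.target p q (m.comp n) = TelMor.target p q m := by
  change m.base = ⟨n.base.rot, n.base.trans + n.shift⟩ at h
  refine IOpq.ext ?_ ?_
  · change n.base.rot = m.base.rot
    rw [h]
  · change n.base.trans + (m.shift + n.shift) = m.base.trans + m.shift
    rw [h]
    change n.base.trans + (m.shift + n.shift) = (n.base.trans + n.shift) + m.shift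
    rw [add_comm m.shift, add_assoc]

/-- Multiplication is compatible with composition, so `Tel(p,q)` is a strict 2-group. -/
theorem TelMor.mul_comp_mul {p q : ℕ} (m m' n n' : TelMor p q)
    (h : TelMor.source p q m = TelMor.target p q m') :
    (m * n).comp (m' * n') = m.comp m' * n.comp n' := by
  change m.base = ⟨m'.base.rot, m'.base.trans + m'.shift⟩ at h
  refine TelMor.ext rfl ?_
  simp only [TelMor.comp, TelMor.mul_shift, map_add, h]
  abel

/-- The homomorphism `t : ℝ^{p,q} → IO(p,q)` of the crossed module of `Tel(p,q)`, sending
`v = ((1, 0), v)` to its target. -/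
def crossedT {p q : ℕ} (v : Rpq p q) : IOpq p q := TelMor.target p q ⟨1, v⟩

/-- The action `α` of `IO(p,q)` on `ℝ^{p,q}` of the crossed module of `Tel(p,q)`: conjugation
with identity morphisms. -/
def crossedα {p q : ℕ} (a : IOpq p q) (w : Rpq p q) : Rpq p q :=
  (TelMor.ident p q a * ⟨1, w⟩ * (TelMor.ident p q a)⁻¹).shift

theorem crossedα_eq {p q : ℕ} (a : IOpq p q) (w : Rpq p q) : crossedα a w = a.rot.toEnd w := by
  simp [crossedα, TelMor.ident]

/-- The map `ℝ^{p,q} → 𝔦𝔬(p,q)`, `v ↦ (0, v)`, of the infinitesimal crossed module. -/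
def infT {p q : ℕ} (v : Rpq p q) : Aff p q := ioMk 0 v

/-- `infT` is the derivative of `crossedT`. -/
theorem hasDerivAt_crossedT {p q : ℕ} (v : Rpq p q) :
    HasDerivAt (fun r : ℝ => (crossedT (r • v)).mat) (infT v) 0 := by
  have h : (fun r : ℝ => (crossedT (r • v)).mat) = fun r : ℝ => 1 + r • infT v := by
    funext r
    refine ContinuousLinearMap.ext fun u => ?_
    rw [add_apply, smul_apply]
    simp only [crossedT, IOpq.mat, infT, ioMk, affMk_apply, one_apply_eq_self]
    change (u.1 + u.2 • (0 + r • v), 1 * u.2) = _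
    ext <;> simp [mul_left_comm]
  rw [h]
  simpa using ((hasDerivAt_id (0 : ℝ)).smul_const (infT v)).const_add 1

/-! ## Differential forms and gauge transformations -/

section Forms

variable {E : Type*} [NormedAddCommGroup E] [NormedSpace ℝ E]
  {M : Type*} [TopologicalSpace M] [ChartedSpace E M]
  {W : Type*} [NormedAddCommGroup W] [NormedSpace ℝ W]

/-- Smoothness on `U` of a `W`-valued 1-form. -/
def SmoothForm1 [IsManifold 𝓘(ℝ, E) ∞ M] (A : ∀ x : M, TangentSpace 𝓘(ℝ, E) x →L[ℝ] W)
    (U : Opens M) : Prop :=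
  ContMDiffOn 𝓘(ℝ, E) (𝓘(ℝ, E).prod 𝓘(ℝ, E →L[ℝ] W)) ∞
    (fun x => (TotalSpace.mk' (E →L[ℝ] W) x (A x) :
      TotalSpace (E →L[ℝ] W) fun x : M => TangentSpace 𝓘(ℝ, E) x →L[ℝ] Trivial M W x)) U

/-- Smoothness on `U` of a `W`-valued 2-form. -/
def SmoothForm2 [IsManifold 𝓘(ℝ, E) ∞ M]
    (B : ∀ x : M, TangentSpace 𝓘(ℝ, E) x →L[ℝ] TangentSpace 𝓘(ℝ, E) x →L[ℝ] W)
    (U : Opens M) : Prop :=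
  ContMDiffOn 𝓘(ℝ, E) (𝓘(ℝ, E).prod 𝓘(ℝ, E →L[ℝ] E →L[ℝ] W)) ∞
    (fun x => (TotalSpace.mk' (E →L[ℝ] E →L[ℝ] W) x (B x) :
      TotalSpace (E →L[ℝ] E →L[ℝ] W) fun x : M =>
        TangentSpace 𝓘(ℝ, E) x →L[ℝ] TangentSpace 𝓘(ℝ, E) x →L[ℝ] Trivial M W x)) U

/-- The 1-form `A`, written in the chart `φ` around `x`: the pullback of `A` along `φ⁻¹`. -/
def chartForm (A : ∀ x : M, TangentSpace 𝓘(ℝ, E) x →L[ℝ] W) (x : M) (z : E) : E →L[ℝ] W :=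
  (A ((extChartAt 𝓘(ℝ, E) x).symm z)).comp
    (mfderiv 𝓘(ℝ, E) 𝓘(ℝ, E) (extChartAt 𝓘(ℝ, E) x).symm z)

/-- The exterior derivative `dA(v, w)` at `x` of a `W`-valued 1-form `A`, computed in the
chart around `x`. -/
def dForm (A : ∀ x : M, TangentSpace 𝓘(ℝ, E) x →L[ℝ] W) (x : M)
    (v w : TangentSpace 𝓘(ℝ, E) x) : W :=
  extDeriv (fun z : E => ContinuousAlternatingMap.ofSubsingleton ℝ E W (0 : Fin 1)
      (chartForm A x z)) (extChartAt 𝓘(ℝ, E) x x)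
    ![mfderiv 𝓘(ℝ, E) 𝓘(ℝ, E) (extChartAt 𝓘(ℝ, E) x) x v,
      mfderiv 𝓘(ℝ, E) 𝓘(ℝ, E) (extChartAt 𝓘(ℝ, E) x) x w]

/-- The differential `dg` of a function with values in a vector space. -/
def dFun (g : M → W) (x : M) : TangentSpace 𝓘(ℝ, E) x →L[ℝ] W := mfderiv 𝓘(ℝ, E) 𝓘(ℝ, W) g x

variable {𝔸 : Type*} [NormedRing 𝔸] [NormedAlgebra ℝ 𝔸]

/-- The curvature `(dA + A ∧ A)(v, w) = dA(v, w) + [A(v), A(w)]` at `x` of a 1-form `A` with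
values in a matrix Lie algebra. -/
def curvature (A : ∀ x : M, TangentSpace 𝓘(ℝ, E) x →L[ℝ] 𝔸) (x : M)
    (v w : TangentSpace 𝓘(ℝ, E) x) : 𝔸 :=
  dForm A x v w + ⁅A x v, A x w⁆

/-- The value on `v` of the gauge transform `g A g⁻¹ + g d(g⁻¹)`, for a function `g` with values
in a matrix group and with inverse `g'`. -/
def gaugeTransform (g g' : M → 𝔸) {x : M} (A : TangentSpace 𝓘(ℝ, E) x →L[ℝ] 𝔸)
    (v : TangentSpace 𝓘(ℝ, E) x) : 𝔸 :=
  g x * A v * g' x + g x * dFun g' x v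

end Forms

/-! ## The fake tangent bundle, its frame bundle, and the teleparallel 2-bundle -/

section Bundles

variable (p q : ℕ)
  {E : Type*} [NormedAddCommGroup E] [NormedSpace ℝ E]
  {M : Type*} [TopologicalSpace M] [ChartedSpace E M] [IsManifold 𝓘(ℝ, E) ∞ M]
  (F : Type*) [NormedAddCommGroup F] [NormedSpace ℝ F]
  (V : M → Type*) [TopologicalSpace (TotalSpace F V)]
  [∀ x, AddCommGroup (V x)] [∀ x, Module ℝ (V x)] [∀ x, TopologicalSpace (V x)]
  [∀ x, IsTopologicalAddGroup (V x)] [∀ x, ContinuousSMul ℝ (V x)]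
  [FiberBundle F V] [VectorBundle ℝ F V] [ContMDiffVectorBundle ∞ F V 𝓘(ℝ, E)]

/-- The structure making the vector bundle `V → M` a fake tangent bundle: a smooth metric of
signature `(p,q)`, and the existence of an isomorphism of smooth vector bundles `TM ≅ V`. -/
structure FakeTangentBundle where
  /-- the metric -/
  metric : ∀ x, V x →L[ℝ] V x →L[ℝ] ℝ
  symm : ∀ x v w, metric x v w = metric x w v
  signature : ∀ x, ∃ f : Rpq p q ≃L[ℝ] V x, ∀ v w, metric x (f v) (f w) = stdMetric v w
  smooth : ContMDiff 𝓘(ℝ, E) (𝓘(ℝ, E).prod 𝓘(ℝ, F →L[ℝ] F →L[ℝ] ℝ)) ∞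
    (fun x => (TotalSpace.mk' (F →L[ℝ] F →L[ℝ] ℝ) x (metric x) :
      TotalSpace (F →L[ℝ] F →L[ℝ] ℝ) fun x : M => V x →L[ℝ] V x →L[ℝ] Trivial M ℝ x))
  exists_iso : ∃ Ψ : ∀ x : M, TangentSpace 𝓘(ℝ, E) x ≃L[ℝ] V x,
    ContMDiff 𝓘(ℝ, E) (𝓘(ℝ, E).prod 𝓘(ℝ, E →L[ℝ] F)) ∞
      (fun x => (TotalSpace.mk' (E →L[ℝ] F) x (Ψ x : TangentSpace 𝓘(ℝ, E) x →L[ℝ] V x) :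
        TotalSpace (E →L[ℝ] F) fun x : M => TangentSpace 𝓘(ℝ, E) x →L[ℝ] V x))

variable {p q F V}
variable (T : FakeTangentBundle (E := E) p q F V)

/-- The fibre at `x` of the fake frame bundle: the linear isometries `ℝ^{p,q} → V x`. -/
@[ext] structure Frame (x : M) where
  /-- the underlying linear isomorphism -/
  toEquiv : Rpq p q ≃L[ℝ] V x
  isometry : ∀ v w, T.metric x (toEquiv v) (toEquiv w) = stdMetric v w

variable {T}

/-- The right action of `O(p,q)` on frames. -/
def Frame.act {x : M} (f : Frame T x) (k : Opq p q) : Frame T x where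
  toEquiv := (k : Rpq p q ≃L[ℝ] Rpq p q).trans f.toEquiv
  isometry v w := (f.isometry _ _).trans (k.2 v w)

/-- The linear map `f⁻¹ f'` relating two frames at the same point. -/
def Frame.change {x : M} (f f' : Frame T x) : EndR p q :=
  (f'.toEquiv.trans f.toEquiv.symm : Rpq p q ≃L[ℝ] Rpq p q)

variable (T)

/-- Smoothness on `U` of a section of the fake frame bundle. -/
def SmoothFrame (U : Opens M) (s : ∀ x : M, Frame T x) : Prop :=
  ∀ v : Rpq p q, ContMDiffOn 𝓘(ℝ, E) (𝓘(ℝ, E).prod 𝓘(ℝ, F)) ∞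
    (fun x => (TotalSpace.mk' F x ((s x).toEquiv v) : TotalSpace F V)) U

/-- A smooth local section of the fake frame bundle, over the open set `U`. The values outside
`U` are irrelevant. -/
structure LocalFrame where
  /-- the domain -/
  U : Opens M
  /-- the frames -/
  s : ∀ x : M, Frame T x
  smooth : SmoothFrame T U s

/-- Equivalence of pairs `(f k, a) ∼ (f, k a)` for a space `S` on which `O(p,q)` acts from the
left. -/
def assocSetoid (S : Type) [MulAction (Opq p q) S] (x : M) : Setoid (Frame T x × S) where
  r y z := ∃ k : Opq p q, y.1 = z.1.act k ∧ k • y.2 = z.2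
  iseqv :=
    { refl := fun y => ⟨1, rfl, one_smul _ _⟩
      symm := by
        rintro ⟨f, a⟩ ⟨f', a'⟩ ⟨k, h1, h2⟩
        refine ⟨k⁻¹, ?_, ?_⟩
        · dsimp only at h1 ⊢
          rw [h1]
          refine Frame.ext (ContinuousLinearEquiv.ext (funext fun v => ?_))
          exact congrArg f'.toEquiv (Opq.toEnd_apply_inv k v).symm
        · dsimp only at h2 ⊢
          rw [← h2, inv_smul_smul]
      trans := by
        rintro ⟨f, a⟩ ⟨f', a'⟩ ⟨f'', a''⟩ ⟨k, h1, h2⟩ ⟨k', h1', h2'⟩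
        dsimp only at h1 h2 h1' h2'
        refine ⟨k' * k, ?_, ?_⟩
        · dsimp only
          rw [h1, h1']
          rfl
        · dsimp only
          rw [mul_smul, h2, h2'] }

/-- The fibre at `x` of the bundle associated to the fake frame bundle with fibre `S`. -/
def Assoc (S : Type) [MulAction (Opq p q) S] (x : M) : Type _ := Quotient (assocSetoid T S x)

variable {T}

/-- The class `[f, a]`. -/
def Assoc.mk {S : Type} [MulAction (Opq p q) S] {x : M} (f : Frame T x) (a : S) : Assoc T S x :=
  Quotient.mk (assocSetoid T S x) (f, a)

/-- The map of associated bundles induced by an equivariant map of fibres. -/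
def Assoc.map {S S' : Type} [MulAction (Opq p q) S] [MulAction (Opq p q) S'] (φ : S → S')
    (hφ : ∀ (k : Opq p q) (a : S), φ (k • a) = k • φ a) {x : M} :
    Assoc T S x → Assoc T S' x :=
  Quotient.map (fun y => (y.1, φ y.2)) (by
    rintro ⟨f, a⟩ ⟨f', a'⟩ ⟨k, h1, h2⟩
    exact ⟨k, h1, by dsimp only at h2 ⊢; rw [← hφ, h2]⟩)

/-- `O(p,q)` acts on the objects of `Tel(p,q)` by left multiplication. -/
instance : MulAction (Opq p q) (IOpq p q) := MulAction.compHom _ (IOpq.ofO p q)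

/-- `O(p,q)` acts on the morphisms of `Tel(p,q)` by left multiplication with identity
morphisms. -/
instance : MulAction (Opq p q) (TelMor p q) :=
  MulAction.compHom _ ((TelMor.ident p q).comp (IOpq.ofO p q))

theorem TelMor.target_smul (k : Opq p q) (m : TelMor p q) :
    TelMor.target p q (k • m) = k • TelMor.target p q m := by
  change TelMor.target p q (TelMor.ident p q (IOpq.ofO p q k) * m) = _
  rw [map_mul]
  exact congrArg (· * TelMor.target p q m) (IOpq.ext rfl (add_zero 0))

variable (T) in
/-- The objects over `x` of the teleparallel 2-bundle `ℱ ×_{O(p,q)} Tel(p,q)`. -/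
def TelBundleObj (x : M) : Type _ := Assoc T (IOpq p q) x

variable (T) in
/-- The morphisms over `x` of the teleparallel 2-bundle `ℱ ×_{O(p,q)} Tel(p,q)`. -/
def TelBundleMor (x : M) : Type _ := Assoc T (TelMor p q) x

/-- The right action of `IO(p,q)` on the objects of the teleparallel 2-bundle. -/
def TelBundleObj.act {x : M} (y : TelBundleObj T x) (b : IOpq p q) : TelBundleObj T x :=
  Assoc.map (fun a => a * b) (fun _ _ => mul_assoc _ _ _) y

/-- The right action of the morphisms of `Tel(p,q)` on those of the teleparallel 2-bundle. -/
def TelBundleMor.act {x : M} (y : TelBundleMor T x) (n : TelMor p q) : TelBundleMor T x :=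
  Assoc.map (fun m => m * n) (fun _ _ => mul_assoc _ _ _) y

/-- The source of a morphism of the teleparallel 2-bundle. -/
def TelBundleMor.source {x : M} (y : TelBundleMor T x) : TelBundleObj T x :=
  Assoc.map (TelMor.source p q) (fun _ _ => map_mul _ _ _) y

/-- The target of a morphism of the teleparallel 2-bundle. -/
def TelBundleMor.target {x : M} (y : TelBundleMor T x) : TelBundleObj T x :=
  Assoc.map (TelMor.target p q) TelMor.target_smul y

/-- The identity morphism of an object of the teleparallel 2-bundle. -/
def TelBundleObj.ident {x : M} (y : TelBundleObj T x) : TelBundleMor T x :=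
  Assoc.map (TelMor.ident p q) (fun _ _ => map_mul _ _ _) y

/-- `c` is the composite `a ∘ b` of morphisms of the teleparallel 2-bundle: composition is
induced by `[f, m] ∘ [f, n] = [f, m ∘ n]`. -/
def TelBundleMor.IsComp {x : M} (c a b : TelBundleMor T x) : Prop :=
  ∃ (f : Frame T x) (m n : TelMor p q), TelMor.source p q m = TelMor.target p q n ∧
    a = Assoc.mk f m ∧ b = Assoc.mk f n ∧ c = Assoc.mk f (m.comp n)

variable (T)

/-- A local trivialization `U × Tel(p,q) ≅ (ℱ ×_{O(p,q)} Tel(p,q))|_U` of the teleparallel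
2-bundle: an isomorphism of right `Tel(p,q)` 2-spaces over `U`, given on objects by `obj` and on
morphisms by `mor`. The values at points outside `U` are irrelevant. By equivariance,
`obj x a = (obj x 1) a`, and `mor x m = (mor x 1) m` with `mor x 1` the identity morphism of
`obj x 1`; so the trivialization is smooth when `x ↦ obj x 1` is, that is, when this section of
the quotient `ℱ ×_{O(p,q)} IO(p,q)` lifts locally to smooth maps to the fake frame bundle and
to `IO(p,q)`. -/
structure LocalTriv where
  /-- the domain -/
  U : Opens M
  /-- the trivialization on objects -/
  obj : ∀ x, IOpq p q ≃ TelBundleObj T x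
  /-- the trivialization on morphisms -/
  mor : ∀ x, TelMor p q ≃ TelBundleMor T x
  obj_mul : ∀ x ∈ U, ∀ a b, obj x (a * b) = (obj x a).act b
  mor_mul : ∀ x ∈ U, ∀ m n, mor x (m * n) = (mor x m).act n
  source_mor : ∀ x ∈ U, ∀ m, (mor x m).source = obj x (TelMor.source p q m)
  target_mor : ∀ x ∈ U, ∀ m, (mor x m).target = obj x (TelMor.target p q m)
  mor_ident : ∀ x ∈ U, ∀ a, mor x (TelMor.ident p q a) = (obj x a).ident
  mor_comp : ∀ x ∈ U, ∀ m n, TelMor.source p q m = TelMor.target p q n →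
    TelBundleMor.IsComp (mor x (m.comp n)) (mor x m) (mor x n)
  smooth : ∀ x₀ ∈ U, ∃ (s : LocalFrame T) (a : M → IOpq p q), x₀ ∈ s.U ∧ s.U ≤ U ∧
    ContMDiffOn 𝓘(ℝ, E) 𝓘(ℝ, Aff p q) ∞ (fun x => (a x).mat) s.U ∧
    ∀ x ∈ s.U, obj x 1 = Assoc.mk (s.s x) (a x)

variable {T}

/-- The transition function `g` of two local trivializations `t`, `t'`, defined on the
intersection of their domains by `t⁻¹(t'(x, 1)) = (x, g(x))`. -/
def LocalTriv.transition (t t' : LocalTriv T) (x : M) : IOpq p q := (t.obj x).symm (t'.obj x 1)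

/-- A strict 2-connection on the teleparallel 2-bundle, with respect to local trivializations
`t i`: on the domain `U i` of `t i` an `𝔦𝔬(p,q)`-valued 1-form `A i` and an `ℝ^{p,q}`-valued 2-form
`B i` such that `dA + A ∧ A = t(B)`, related by the transition functions on the intersections
`U i ∩ U j`. Forms on `U i` are extended by zero to `M`. -/
@[ext] structure TwoConnection {ι : Type*} (t : ι → LocalTriv T) where
  /-- the 1-forms -/
  A : ι → ∀ x : M, TangentSpace 𝓘(ℝ, E) x →L[ℝ] Aff p q
  /-- the 2-forms -/
  B : ι → ∀ x : M, TangentSpace 𝓘(ℝ, E) x →L[ℝ] TangentSpace 𝓘(ℝ, E) x →L[ℝ] Rpq p q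
  A_mem : ∀ i x v, A i x v ∈ io p q
  A_smooth : ∀ i, SmoothForm1 (A i) (t i).U
  A_zero : ∀ i, ∀ x ∉ (t i).U, A i x = 0
  B_alt : ∀ i x v, B i x v v = 0
  B_smooth : ∀ i, SmoothForm2 (B i) (t i).U
  B_zero : ∀ i, ∀ x ∉ (t i).U, B i x = 0
  fake_flat : ∀ i, ∀ x ∈ (t i).U, ∀ v w, curvature (A i) x v w = infT (B i x v w)
  glue_A : ∀ i j, ∀ x ∈ (t i).U ⊓ (t j).U, ∀ v,
    A i x v = gaugeTransform (fun y => ((t i).transition (t j) y).mat)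
      (fun y => ((t i).transition (t j) y)⁻¹.mat) (A j x) v
  glue_B : ∀ i j, ∀ x ∈ (t i).U ⊓ (t j).U, ∀ v w,
    B i x v w = crossedα ((t i).transition (t j) x) (B j x v w)

/-! ## Connections on the fake frame bundle, and torsion -/

variable (T)

/-- A connection `θ` on the fake frame bundle, given by its local connection forms: `form s` is
the pullback `s^*θ` along the local section `s`, extended by zero outside the domain of `s`.
The rule relating `s^*θ` and `s'^*θ` for `s' = s g` expresses that `θ` is equivariant and
reproduces the generators of the action of `O(p,q)`. -/
@[ext] structure Connection where
  /-- the local connection forms -/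
  form : LocalFrame T → ∀ x : M, TangentSpace 𝓘(ℝ, E) x →L[ℝ] EndR p q
  mem : ∀ s x v, form s x v ∈ opq p q
  smooth : ∀ s, SmoothForm1 (form s) s.U
  zero : ∀ s : LocalFrame T, ∀ x ∉ s.U, form s x = 0
  glue : ∀ s s' : LocalFrame T, ∀ x ∈ s.U ⊓ s'.U, ∀ v,
    form s x v = gaugeTransform (fun y => (s.s y).change (s'.s y))
      (fun y => (s'.s y).change (s.s y)) (form s' x) v

/-- A `V`-valued 1-form, i.e. a morphism of smooth vector bundles `TM → V`. -/
@[ext] structure Form1 (_T : FakeTangentBundle (E := E) p q F V) where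
  /-- the values -/
  val : ∀ x : M, TangentSpace 𝓘(ℝ, E) x →L[ℝ] V x
  smooth : ContMDiff 𝓘(ℝ, E) (𝓘(ℝ, E).prod 𝓘(ℝ, E →L[ℝ] F)) ∞
    (fun x => (TotalSpace.mk' (E →L[ℝ] F) x (val x) :
      TotalSpace (E →L[ℝ] F) fun x : M => TangentSpace 𝓘(ℝ, E) x →L[ℝ] V x))

/-- A `V`-valued 2-form. -/
@[ext] structure Form2 (_T : FakeTangentBundle (E := E) p q F V) where
  /-- the values -/
  val : ∀ x : M, TangentSpace 𝓘(ℝ, E) x →L[ℝ] TangentSpace 𝓘(ℝ, E) x →L[ℝ] V x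
  alt : ∀ x v, val x v v = 0
  smooth : ContMDiff 𝓘(ℝ, E) (𝓘(ℝ, E).prod 𝓘(ℝ, E →L[ℝ] E →L[ℝ] F)) ∞
    (fun x => (TotalSpace.mk' (E →L[ℝ] E →L[ℝ] F) x (val x) :
      TotalSpace (E →L[ℝ] E →L[ℝ] F) fun x : M =>
        TangentSpace 𝓘(ℝ, E) x →L[ℝ] TangentSpace 𝓘(ℝ, E) x →L[ℝ] V x))

variable {T}

/-- The connection is flat: its curvature `R = dθ + θ ∧ θ` vanishes. -/
def Connection.IsFlat (θ : Connection T) : Prop :=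
  ∀ s : LocalFrame T, ∀ x ∈ s.U, ∀ v w, curvature (θ.form s) x v w = 0

/-- The covariant derivative `D_v σ` at `x` of a section `σ` of `V`, for the connection on `V`
determined by `θ`, computed with a local section `s` of the fake frame bundle:
for `σ = s f`, `D_v σ = s (df(v) + θ(v) f)`. -/
def Connection.covDeriv (θ : Connection T) (s : LocalFrame T) (σ : ∀ x, V x) (x : M)
    (v : TangentSpace 𝓘(ℝ, E) x) : V x :=
  (s.s x).toEquiv
    (dFun (fun y => (s.s y).toEquiv.symm (σ y)) x v
      + θ.form s x v ((s.s x).toEquiv.symm (σ x)))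

/-- `τ` is the covariant exterior derivative `d_θ e`, i.e. the torsion:
`τ(X, Y) = D_X (e(Y)) - D_Y (e(X)) - e([X, Y])` for vector fields `X`, `Y`. -/
def IsTorsion (θ : Connection T) (e : Form1 T) (τ : Form2 T) : Prop :=
  ∀ (s : LocalFrame T), ∀ x ∈ s.U, ∀ X Y : ∀ y : M, TangentSpace 𝓘(ℝ, E) y,
    ContMDiffAt 𝓘(ℝ, E) 𝓘(ℝ, E).tangent ∞ (fun y => (⟨y, X y⟩ : TangentBundle 𝓘(ℝ, E) M)) x →
    ContMDiffAt 𝓘(ℝ, E) 𝓘(ℝ, E).tangent ∞ (fun y => (⟨y, Y y⟩ : TangentBundle 𝓘(ℝ, E) M)) x →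
    τ.val x (X x) (Y x) = θ.covDeriv s (fun y => e.val y (Y y)) x (X x)
      - θ.covDeriv s (fun y => e.val y (X y)) x (Y x)
      - e.val x (VectorField.mlieBracket 𝓘(ℝ, E) X Y x)

/-- The 1-form part of the 2-connection `C` is `θ + e`: the 1-forms `A i` are the local forms
of a connection on the bundle of objects `ℱ ×_{O(p,q)} IO(p,q)` of the teleparallel 2-bundle,
whose pullback to the fake frame bundle `ℱ` has `𝔬(p,q)`-part `θ` and `ℝ^{p,q}`-part `f⁻¹ ∘ e` at
a frame `f`. In formulas: if the section of the bundle of objects defined by the trivialization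
`t i` is `[s, a]`, then `A i = a⁻¹ (s^*θ + s⁻¹ e) a + a⁻¹ da`. -/
def TwoConnection.HasOneFormPart {ι : Type*} {t : ι → LocalTriv T} (C : TwoConnection t)
    (θ : Connection T) (e : Form1 T) : Prop :=
  ∀ (i : ι) (s : LocalFrame T) (a : M → IOpq p q),
    (∀ x ∈ (t i).U ⊓ s.U, (t i).obj x 1 = Assoc.mk (s.s x) (a x)) →
    ∀ x ∈ (t i).U ⊓ s.U, ∀ v, C.A i x v = (a x)⁻¹.mat *
        ioMk (θ.form s x v) ((s.s x).toEquiv.symm (e.val x v)) * (a x).mat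
      + (a x)⁻¹.mat * dFun (fun y => (a y).mat) x v

/-- The 2-form part of the 2-connection `C` is the `V`-valued 2-form `τ`: if the section of the
bundle of objects defined by the trivialization `t i` is `[s, a]`, then `τ = s (α(a) (B i))`. -/
def TwoConnection.HasTwoFormPart {ι : Type*} {t : ι → LocalTriv T} (C : TwoConnection t)
    (τ : Form2 T) : Prop :=
  ∀ (i : ι), ∀ x ∈ (t i).U, ∀ (f : Frame T x) (a : IOpq p q), (t i).obj x 1 = Assoc.mk f a →
    ∀ v w, τ.val x v w = f.toEquiv (crossedα a (C.B i x v w))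

end Bundles

end Teleparallel

end

/-! The 1-forms `A i` are the local expressions of one connection on the bundle of objects, taken
with respect to the sections `(x, 1)` of the trivializations. Such a connection has a local
expression along every local section, and the most useful sections are `[s, 1]` for a local frame
`s`. There it is an `𝔦𝔬(p,q)`-valued form `(ξ, u)`. Two local frames differ by an `O(p,q)`-valued
function, which has no translation part, so the gauge law splits: `ξ` obeys the transformation law
of a connection `θ` on the frame bundle, and `s u` is independent of `s`, hence a `V`-valued 1-form
`e`. Conversely `θ + e` can be transported from frames to trivializations. Similarly, the rule `B i
= α(g) (B j)` says exactly that the `B i` represent one `V`-valued 2-form `τ`.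

It remains to interpret fake flatness. By the bracket of `𝔦𝔬(p,q)`, the curvature of `(θ, e)` in a
frame is `(dθ + θ ∧ θ, de + θ ∧ e)`, that is, curvature and torsion (`Connection.curvature_full`).
Curvature is conjugated by gauge transformations (`curvature_gauge`). Conjugating `(R, u)` by an
element with rotation `k` gives rotation part `k R k⁻¹`, and translation part `k u` as soon as `R =
0`. So `dA + A ∧ A = (0, B)` in a trivialization is equivalent to `R = 0` together with the equality
of the torsion and the vector represented by `B`; this is `curvature_eq_infT_iff`, and it serves
both directions of the theorem.

Two tools carry the rest. The objects over a point form an `IO(p,q)`-torsor; the difference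
`TelBundleObj.diff` satisfies a cocycle identity and `gauge_mul` makes gauge transformation an
action, so local forms can be transported between arbitrary smooth sections (`extendForm`). The
formula `dA(X, Y) = X(A(Y)) - Y(A(X)) - A([X, Y])` (`dForm_apply_fields`) identifies the chart
computation of `d` with the definition of torsion, and also shows that the torsion is smooth. -/

set_option linter.unusedSectionVars false

noncomputable section

namespace Teleparallel

/-! ## Gauge transformations of matrix-valued forms on a normed space -/

section NormedSpace

variable {E : Type*} [NormedAddCommGroup E] [NormedSpace ℝ E]
  {𝔸 : Type*} [NormedRing 𝔸] [NormedAlgebra ℝ 𝔸]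

/-- The curvature of a gauge transform `g a g' + g dg'`, where `g'` is the inverse of `g`. -/
theorem fderiv_gauge_sub_add_bracket {g g' : E → 𝔸} {a b : E → E →L[ℝ] 𝔸} {z : E}
    (hg : ContDiffAt ℝ 2 g z) (hg' : ContDiffAt ℝ 2 g' z) (hb : DifferentiableAt ℝ b z)
    (h : ∀ᶠ y in 𝓝 z, g y * g' y = 1) (h' : ∀ᶠ y in 𝓝 z, g' y * g y = 1)
    (hab : ∀ᶠ y in 𝓝 z, ∀ v, a y v = g y * b y v * g' y + g y * fderiv ℝ g' y v) (v w : E) :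
    fderiv ℝ a z v w - fderiv ℝ a z w v + ⁅a z v, a z w⁆ =
      g z * (fderiv ℝ b z v w - fderiv ℝ b z w v + ⁅b z v, b z w⁆) * g' z := by
  have dg : DifferentiableAt ℝ g z := hg.differentiableAt (by norm_num)
  have dg' : DifferentiableAt ℝ g' z := hg'.differentiableAt (by norm_num)
  have ddg' : DifferentiableAt ℝ (fderiv ℝ g') z :=
    (hg'.fderiv_right (m := 1) (by norm_num)).differentiableAt (by norm_num)
  -- The second derivative of `g'` is symmetric, so it drops out of the antisymmetrized expression.
  have sym : fderiv ℝ (fderiv ℝ g') z v w = fderiv ℝ (fderiv ℝ g') z w v :=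
    (hg'.isSymmSndFDerivAt (by simp)) v w
  have key : ∀ u u' : E, fderiv ℝ a z u u' =
      fderiv ℝ g z u * b z u' * g' z + g z * fderiv ℝ b z u u' * g' z
        + g z * b z u' * fderiv ℝ g' z u
        + (fderiv ℝ g z u * fderiv ℝ g' z u' + g z * fderiv ℝ (fderiv ℝ g') z u u') := by
    intro u u'
    have e : a =ᶠ[𝓝 z] fun y => ((ContinuousLinearMap.mul ℝ 𝔸 (g y)).comp
        (((ContinuousLinearMap.mul ℝ 𝔸).flip (g' y)).comp (b y)))
        + (ContinuousLinearMap.mul ℝ 𝔸 (g y)).comp (fderiv ℝ g' y) := by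
      filter_upwards [hab] with y hy
      ext v
      simp [hy, mul_assoc]
    have da : DifferentiableAt ℝ a z := by
      refine DifferentiableAt.congr_of_eventuallyEq ?_ e
      have h1 : DifferentiableAt ℝ (fun y => ContinuousLinearMap.mul ℝ 𝔸 (g y)) z :=
        (ContinuousLinearMap.differentiableAt _).comp z dg
      have h2 : DifferentiableAt ℝ (fun y => (ContinuousLinearMap.mul ℝ 𝔸).flip (g' y)) z :=
        (ContinuousLinearMap.differentiableAt _).comp z dg'
      exact (h1.clm_comp (h2.clm_comp hb)).add (h1.clm_comp ddg')
    have e1 : fderiv ℝ a z u u' = fderiv ℝ (fun y => a y u') z u := by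
      rw [fderiv_clm_apply da (differentiableAt_const u')]
      simp
    have e2 : (fun y => a y u') =ᶠ[𝓝 z]
        fun y => g y * b y u' * g' y + g y * fderiv ℝ g' y u' := by
      filter_upwards [hab] with y hy using hy u'
    have db := hb.hasFDerivAt.clm_apply (hasFDerivAt_const u' z)
    have dd := ddg'.hasFDerivAt.clm_apply (hasFDerivAt_const u' z)
    have := ((dg.hasFDerivAt.mul' db).mul' dg'.hasFDerivAt).add (dg.hasFDerivAt.mul' dd)
    rw [e1, e2.fderiv_eq]
    refine (DFunLike.congr_fun this.fderiv u).trans ?_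
    simp [mul_assoc]
    abel
  have hz := h.self_of_nhds
  have hz' := h'.self_of_nhds
  have az := hab.self_of_nhds
  -- Differentiating `g' g = 1` allows `dg` to be eliminated in favour of `dg'`.
  have dinv : ∀ u : E, g' z * fderiv ℝ g z u = -(fderiv ℝ g' z u * g z) := by
    intro u
    have e0 := (dg'.hasFDerivAt.mul' dg.hasFDerivAt).fderiv
    have e : (g' * g : E → 𝔸) =ᶠ[𝓝 z] fun _ => 1 := h'
    rw [e.fderiv_eq, fderiv_const_apply] at e0
    have := DFunLike.congr_fun e0 u
    simp only [zero_apply, add_apply, smul_apply, smul_eq_mul, op_smul_eq_mul] at this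
    exact eq_neg_of_add_eq_zero_left this.symm
  have dgz : ∀ u : E, fderiv ℝ g z u = -(g z * fderiv ℝ g' z u * g z) := by
    intro u
    rw [← one_mul (fderiv ℝ g z u), ← hz, mul_assoc, dinv, mul_neg, mul_assoc]
  rw [key, key, az, az, sym, Ring.lie_def, Ring.lie_def, dgz v, dgz w]
  -- With `dg = -g dg' g` inserted, only an identity between noncommuting symbols is left, in which
  -- `H G = 1` is the single relation to be applied.
  generalize fderiv ℝ g' z v = p
  generalize fderiv ℝ g' z w = r
  generalize b z v = c
  generalize b z w = d
  generalize fderiv ℝ b z v w = k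
  generalize fderiv ℝ b z w v = l
  generalize fderiv ℝ (fderiv ℝ g') z w v = m
  generalize g z = G at *
  generalize g' z = H at *
  have c1 : ∀ x, H * (G * x) = x := fun x => by rw [← mul_assoc, hz', one_mul]
  have c2 : ∀ x, G * (H * x) = x := fun x => by rw [← mul_assoc, hz, one_mul]
  simp only [mul_add, add_mul, mul_sub, sub_mul, neg_mul, mul_assoc, c1]
  abel

end NormedSpace

/-! ## Sections of homomorphism bundles -/

section HomBundle

variable {E : Type*} [NormedAddCommGroup E] [NormedSpace ℝ E]
  {M : Type*} [TopologicalSpace M] [ChartedSpace E M]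
  {F₁ : Type*} [NormedAddCommGroup F₁] [NormedSpace ℝ F₁]
  {V₁ : M → Type*} [TopologicalSpace (TotalSpace F₁ V₁)]
  [∀ x, AddCommGroup (V₁ x)] [∀ x, Module ℝ (V₁ x)] [∀ x, TopologicalSpace (V₁ x)]
  [FiberBundle F₁ V₁] [VectorBundle ℝ F₁ V₁]
  {F₂ : Type*} [NormedAddCommGroup F₂] [NormedSpace ℝ F₂]
  {V₂ : M → Type*} [TopologicalSpace (TotalSpace F₂ V₂)]
  [∀ x, AddCommGroup (V₂ x)] [∀ x, Module ℝ (V₂ x)] [∀ x, TopologicalSpace (V₂ x)]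
  [∀ x, IsTopologicalAddGroup (V₂ x)] [∀ x, ContinuousSMul ℝ (V₂ x)]
  [FiberBundle F₂ V₂] [VectorBundle ℝ F₂ V₂]

/-- A function with values in the linear maps on a finite-dimensional space is smooth if its
evaluations are. -/
theorem contMDiffAt_clm_of_apply [FiniteDimensional ℝ F₁] {f : M → F₁ →L[ℝ] F₂} {x : M}
    (h : ∀ v, ContMDiffAt 𝓘(ℝ, E) 𝓘(ℝ, F₂) ∞ (fun y => f y v) x) :
    ContMDiffAt 𝓘(ℝ, E) 𝓘(ℝ, F₁ →L[ℝ] F₂) ∞ f x := by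
  let b := Module.finBasis ℝ F₁
  have e : f = fun y => ∑ i, ContinuousLinearMap.smulRightL ℝ F₁ F₂
      (LinearMap.toContinuousLinearMap (b.coord i)) (f y (b i)) := by
    funext y
    refine ContinuousLinearMap.ext fun v => ?_
    conv_lhs => rw [← b.sum_repr v, map_sum]
    simp
  rw [e]
  refine ContMDiffAt.sum fun i _ => ?_
  exact (ContinuousLinearMap.contMDiff _).contMDiffAt.comp x (h (b i))

/-- A section of a bundle of homomorphisms, from a bundle of finite rank, is smooth if its values
on the sections that are constant in a trivialization are. -/
theorem contMDiffAt_hom_of_apply [FiniteDimensional ℝ F₁] {φ : ∀ x, V₁ x →L[ℝ] V₂ x} {x : M}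
    (h : ∀ v : F₁, ContMDiffAt 𝓘(ℝ, E) (𝓘(ℝ, E).prod 𝓘(ℝ, F₂)) ∞
      (fun y => (TotalSpace.mk' F₂ y (φ y ((trivializationAt F₁ V₁ x).symmL ℝ y v)) :
        TotalSpace F₂ V₂)) x) :
    ContMDiffAt 𝓘(ℝ, E) (𝓘(ℝ, E).prod 𝓘(ℝ, F₁ →L[ℝ] F₂)) ∞
      (fun y => (TotalSpace.mk' (F₁ →L[ℝ] F₂) y (φ y) :
        TotalSpace (F₁ →L[ℝ] F₂) fun y => V₁ y →L[ℝ] V₂ y)) x := by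
  rw [contMDiffAt_hom_bundle]
  refine ⟨contMDiffAt_id, contMDiffAt_clm_of_apply fun v => ?_⟩
  have := (contMDiffAt_totalSpace.1 (h v)).2
  refine this.congr_of_eventuallyEq ?_
  filter_upwards [(trivializationAt F₂ V₂ x).open_baseSet.mem_nhds
    (mem_baseSet_trivializationAt F₂ V₂ x)] with y hy
  simp [ContinuousLinearMap.inCoordinates, hy]

theorem contMDiffAt_mk_trivial {f : M → F₂} {x : M} :
    ContMDiffAt 𝓘(ℝ, E) (𝓘(ℝ, E).prod 𝓘(ℝ, F₂)) ∞
      (fun y => (TotalSpace.mk' F₂ y (f y) : TotalSpace F₂ (Trivial M F₂))) x ↔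
    ContMDiffAt 𝓘(ℝ, E) 𝓘(ℝ, F₂) ∞ f x := by
  rw [contMDiffAt_totalSpace]
  exact ⟨fun h => h.2, fun h => ⟨contMDiffAt_id, h⟩⟩

end HomBundle

/-! ## Vector fields -/

section VectorFields

variable {E : Type*} [NormedAddCommGroup E] [NormedSpace ℝ E]
  {M : Type*} [TopologicalSpace M] [ChartedSpace E M] [IsManifold 𝓘(ℝ, E) ∞ M]

/-- The vector field `X` is smooth at `x`. -/
def SmoothField (X : ∀ y : M, TangentSpace 𝓘(ℝ, E) y) (x : M) : Prop :=
  ContMDiffAt 𝓘(ℝ, E) 𝓘(ℝ, E).tangent ∞ (fun y => (⟨y, X y⟩ : TangentBundle 𝓘(ℝ, E) M)) x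

/-- The vector field that is constant in the trivialization at `x`. -/
def constField (x : M) (v : E) (y : M) : TangentSpace 𝓘(ℝ, E) y :=
  (trivializationAt E (TangentSpace 𝓘(ℝ, E) : M → Type _) x).symmL ℝ y v

theorem smoothField_constField_of_mem {x y : M} (v : E)
    (hy : y ∈ (trivializationAt E (TangentSpace 𝓘(ℝ, E) : M → Type _) x).baseSet) :
    SmoothField (constField (E := E) x v) y := by
  have h := (trivializationAt E (TangentSpace 𝓘(ℝ, E) : M → Type _) x).contMDiffAt_symmL
    (IB := 𝓘(ℝ, E)) (n := ∞) hy
  exact h.clm_bundle_apply (contMDiffAt_mk_trivial.2 contMDiffAt_const)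

/-- Smoothness on a neighbourhood, not only at `x`, is needed to use the formula for `dA(X, Y)` at
all nearby points. -/
theorem eventually_smoothField_constField (x : M) (v : E) :
    ∀ᶠ y in 𝓝 x, SmoothField (constField (E := E) x v) y := by
  filter_upwards [(trivializationAt E (TangentSpace 𝓘(ℝ, E) : M → Type _) x).open_baseSet.mem_nhds
    (mem_baseSet_trivializationAt E _ x)] with y hy
  exact smoothField_constField_of_mem v hy

theorem smoothField_constField (x : M) (v : E) :
    SmoothField (constField (E := E) x v) x :=
  smoothField_constField_of_mem v (mem_baseSet_trivializationAt E _ x)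

/-- The inverse of the trivialization is the derivative of the inverse chart, and the chart around
`x` identifies the tangent space at `x` with `E` by the identity. -/
theorem constField_self (x : M) (v : TangentSpace 𝓘(ℝ, E) x) : constField (E := E) x v x = v := by
  have h := TangentBundle.symmL_trivializationAt (I := 𝓘(ℝ, E)) (mem_chart_source E x)
  rw [mfderivWithin_range_extChartAt_symm] at h
  exact DFunLike.congr_fun h v

theorem exists_smoothField (x : M) (v : TangentSpace 𝓘(ℝ, E) x) :
    ∃ X : ∀ y : M, TangentSpace 𝓘(ℝ, E) y, SmoothField X x ∧ X x = v :=
  ⟨_, smoothField_constField (E := E) x v, constField_self (E := E) x v⟩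

theorem SmoothField.mlieBracket [CompleteSpace E] {X Y : ∀ y : M, TangentSpace 𝓘(ℝ, E) y} {x : M}
    (hX : SmoothField X x) (hY : SmoothField Y x) :
    SmoothField (VectorField.mlieBracket 𝓘(ℝ, E) X Y) x := by
  -- The bracket costs one derivative, but `∞ + 1` unfolds to `∞`.
  have : IsManifold 𝓘(ℝ, E) ((⊤ : ℕ∞) + 1) M := ‹IsManifold 𝓘(ℝ, E) ∞ M›
  have : IsManifold 𝓘(ℝ, E) (minSmoothness ℝ 2) M := by
    rw [minSmoothness_of_isRCLikeNormedField]
    infer_instance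
  exact ContMDiffAt.mlieBracket_vectorField (m := ⊤) (n := ⊤) hX hY (by simp)

end VectorFields

/-! ## Smooth forms -/

section SmoothForms

variable {E : Type*} [NormedAddCommGroup E] [NormedSpace ℝ E] [FiniteDimensional ℝ E]
  {M : Type*} [TopologicalSpace M] [ChartedSpace E M] [IsManifold 𝓘(ℝ, E) ∞ M]
  {F : Type*} [NormedAddCommGroup F] [NormedSpace ℝ F]
  {V : M → Type*} [TopologicalSpace (TotalSpace F V)]
  [∀ x, AddCommGroup (V x)] [∀ x, Module ℝ (V x)] [∀ x, TopologicalSpace (V x)]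
  [∀ x, IsTopologicalAddGroup (V x)] [∀ x, ContinuousSMul ℝ (V x)]
  [FiberBundle F V] [VectorBundle ℝ F V]
  {W : Type*} [NormedAddCommGroup W] [NormedSpace ℝ W]

/-- A bundle-valued 1-form is smooth at a point if and only if its values on vector fields that
are smooth at this point are. -/
theorem contMDiffAt_form1_iff {A : ∀ x : M, TangentSpace 𝓘(ℝ, E) x →L[ℝ] V x} {x : M} :
    ContMDiffAt 𝓘(ℝ, E) (𝓘(ℝ, E).prod 𝓘(ℝ, E →L[ℝ] F)) ∞
      (fun y => (TotalSpace.mk' (E →L[ℝ] F) y (A y) :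
        TotalSpace (E →L[ℝ] F) fun y : M => TangentSpace 𝓘(ℝ, E) y →L[ℝ] V y)) x ↔
    ∀ X : ∀ y : M, TangentSpace 𝓘(ℝ, E) y, SmoothField X x →
      ContMDiffAt 𝓘(ℝ, E) (𝓘(ℝ, E).prod 𝓘(ℝ, F)) ∞
        (fun y => (TotalSpace.mk' F y (A y (X y)) : TotalSpace F V)) x :=
  ⟨fun h _ hX => h.clm_bundle_apply hX,
    fun h => contMDiffAt_hom_of_apply fun v => h _ (smoothField_constField (E := E) x v)⟩

/-- A bundle-valued 2-form is smooth at a point if and only if its values on vector fields that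
are smooth at this point are. -/
theorem contMDiffAt_form2_iff
    {B : ∀ x : M, TangentSpace 𝓘(ℝ, E) x →L[ℝ] TangentSpace 𝓘(ℝ, E) x →L[ℝ] V x} {x : M} :
    ContMDiffAt 𝓘(ℝ, E) (𝓘(ℝ, E).prod 𝓘(ℝ, E →L[ℝ] E →L[ℝ] F)) ∞
      (fun y => (TotalSpace.mk' (E →L[ℝ] E →L[ℝ] F) y (B y) :
        TotalSpace (E →L[ℝ] E →L[ℝ] F) fun y : M =>
          TangentSpace 𝓘(ℝ, E) y →L[ℝ] TangentSpace 𝓘(ℝ, E) y →L[ℝ] V y)) x ↔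
    ∀ X Y : ∀ y : M, TangentSpace 𝓘(ℝ, E) y, SmoothField X x → SmoothField Y x →
      ContMDiffAt 𝓘(ℝ, E) (𝓘(ℝ, E).prod 𝓘(ℝ, F)) ∞
        (fun y => (TotalSpace.mk' F y (B y (X y) (Y y)) : TotalSpace F V)) x :=
  ⟨fun h _ _ hX hY => h.clm_bundle_apply₂ hX hY,
    fun h => contMDiffAt_hom_of_apply fun v => contMDiffAt_hom_of_apply fun w =>
      h _ _ (smoothField_constField (E := E) x v) (smoothField_constField (E := E) x w)⟩

/-- The `W`-valued 1-form `A` is smooth at `x`. -/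
def SmoothForm1At (A : ∀ x : M, TangentSpace 𝓘(ℝ, E) x →L[ℝ] W) (x : M) : Prop :=
  ContMDiffAt 𝓘(ℝ, E) (𝓘(ℝ, E).prod 𝓘(ℝ, E →L[ℝ] W)) ∞
    (fun x => (TotalSpace.mk' (E →L[ℝ] W) x (A x) :
      TotalSpace (E →L[ℝ] W) fun x : M => TangentSpace 𝓘(ℝ, E) x →L[ℝ] Trivial M W x)) x

theorem smoothForm1_iff {A : ∀ x : M, TangentSpace 𝓘(ℝ, E) x →L[ℝ] W} {U : Opens M} :
    SmoothForm1 A U ↔ ∀ x ∈ U, SmoothForm1At A x :=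
  ⟨fun h x hx => (h x hx).contMDiffAt (U.isOpen.mem_nhds hx),
    fun h x hx => (h x hx).contMDiffWithinAt⟩

theorem smoothForm1At_iff {A : ∀ x : M, TangentSpace 𝓘(ℝ, E) x →L[ℝ] W} {x : M} :
    SmoothForm1At A x ↔ ∀ X : ∀ y : M, TangentSpace 𝓘(ℝ, E) y, SmoothField X x →
      ContMDiffAt 𝓘(ℝ, E) 𝓘(ℝ, W) ∞ (fun y => A y (X y)) x := by
  simp_rw [← contMDiffAt_mk_trivial]
  exact contMDiffAt_form1_iff (V := Trivial M W)

theorem smoothForm2_iff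
    {B : ∀ x : M, TangentSpace 𝓘(ℝ, E) x →L[ℝ] TangentSpace 𝓘(ℝ, E) x →L[ℝ] W} {U : Opens M} :
    SmoothForm2 B U ↔ ∀ x ∈ U, ∀ X Y : ∀ y : M, TangentSpace 𝓘(ℝ, E) y,
      SmoothField X x → SmoothField Y x →
        ContMDiffAt 𝓘(ℝ, E) 𝓘(ℝ, W) ∞ (fun y => B y (X y) (Y y)) x := by
  simp_rw [← contMDiffAt_mk_trivial]
  exact ⟨fun h x hx => contMDiffAt_form2_iff (V := Trivial M W) |>.1
      ((h x hx).contMDiffAt (U.isOpen.mem_nhds hx)),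
    fun h x hx => (contMDiffAt_form2_iff (V := Trivial M W) |>.2 (h x hx)).contMDiffWithinAt⟩

theorem SmoothForm1At.congr {A A' : ∀ x : M, TangentSpace 𝓘(ℝ, E) x →L[ℝ] W} {x : M}
    (h : SmoothForm1At A x) (e : ∀ᶠ y in 𝓝 x, A' y = A y) : SmoothForm1At A' x := by
  refine ContMDiffAt.congr_of_eventuallyEq h ?_
  filter_upwards [e] with y hy
  rw [hy]

end SmoothForms

/-! ## Forms in charts -/

section Charts

variable {E : Type*} [NormedAddCommGroup E] [NormedSpace ℝ E]
  {M : Type*} [TopologicalSpace M] [ChartedSpace E M] [IsManifold 𝓘(ℝ, E) ∞ M]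
  {W : Type*} [NormedAddCommGroup W] [NormedSpace ℝ W]
  {W' : Type*} [NormedAddCommGroup W'] [NormedSpace ℝ W']

theorem eventually_mem_target (x : M) :
    ∀ᶠ z in 𝓝 (extChartAt 𝓘(ℝ, E) x x), z ∈ (extChartAt 𝓘(ℝ, E) x).target :=
  extChartAt_target_mem_nhds x

theorem contMDiffAt_extChartAt_symm (x : M) {z : E} (hz : z ∈ (extChartAt 𝓘(ℝ, E) x).target) :
    ContMDiffAt 𝓘(ℝ, E) 𝓘(ℝ, E) ∞ (extChartAt 𝓘(ℝ, E) x).symm z :=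
  (contMDiffOn_extChartAt_symm x).contMDiffAt ((isOpen_extChartAt_target x).mem_nhds hz)

theorem eventually_extChartAt_symm {x : M} {P : M → Prop} (h : ∀ᶠ y in 𝓝 x, P y) :
    ∀ᶠ z in 𝓝 (extChartAt 𝓘(ℝ, E) x x), P ((extChartAt 𝓘(ℝ, E) x).symm z) :=
  (continuousAt_extChartAt_symm x).eventually (by rwa [extChartAt_to_inv])

/-- The inverse tangent trivialization at `x` is the derivative of the inverse chart, so near `x`
the form `chartForm A x` is the coordinate expression of the section `A`, composed with the inverse
chart. -/
theorem SmoothForm1At.contDiffAt_chartForm {A : ∀ x : M, TangentSpace 𝓘(ℝ, E) x →L[ℝ] W} {x : M}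
    (h : SmoothForm1At A x) :
    ContDiffAt ℝ ∞ (chartForm A x) (extChartAt 𝓘(ℝ, E) x x) := by
  have h1 := ((contMDiffAt_hom_bundle _).1 h).2
  have h2 := ContMDiffAt.comp_of_eq h1
    (contMDiffAt_extChartAt_symm x (mem_extChartAt_target (I := 𝓘(ℝ, E)) x)) (extChartAt_to_inv x)
  refine (contMDiffAt_iff_contDiffAt.1 h2).congr_of_eventuallyEq ?_
  filter_upwards [eventually_mem_target x] with z hz
  have hy : (extChartAt 𝓘(ℝ, E) x).symm z ∈ (chartAt E x).source := by
    rw [← extChartAt_source 𝓘(ℝ, E)]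
    exact (extChartAt 𝓘(ℝ, E) x).map_target hz
  have e := TangentBundle.symmL_trivializationAt (I := 𝓘(ℝ, E)) hy
  rw [(extChartAt 𝓘(ℝ, E) x).right_inv hz] at e
  refine ContinuousLinearMap.ext fun v => ?_
  have e' := DFunLike.congr_fun e v
  rw [modelWithCornersSelf_coe, Set.range_id, mfderivWithin_univ] at e'
  have t : ∀ (y : M) (u : W),
      (trivializationAt W (Trivial M W) x).continuousLinearMapAt ℝ y u = u := fun y u =>
    DFunLike.congr_fun (Trivial.continuousLinearMapAt_trivialization ℝ M W y) u
  exact ((t _ _).trans (congrArg (A _) e')).symm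

theorem chartForm_self (A : ∀ x : M, TangentSpace 𝓘(ℝ, E) x →L[ℝ] W) (x : M) (v : E) :
    chartForm A x (extChartAt 𝓘(ℝ, E) x x) v = A x v := by
  have e := mfderivWithin_range_extChartAt_symm (I := 𝓘(ℝ, E)) (x := x)
  rw [modelWithCornersSelf_coe, Set.range_id, mfderivWithin_univ] at e
  have e' := DFunLike.congr_fun e v
  have k : ∀ (y : M) (hy : y = x) (u : E), A y u = A x u := by
    rintro y rfl u
    rfl
  exact (congrArg (A _) e').trans (k _ (extChartAt_to_inv x) v)

theorem extDeriv_ofSubsingleton_apply {a : E → E →L[ℝ] W} {z : E} (hd : DifferentiableAt ℝ a z)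
    (v w : E) :
    extDeriv (fun z => ContinuousAlternatingMap.ofSubsingleton ℝ E W (0 : Fin 1) (a z)) z ![v, w] =
      fderiv ℝ a z v w - fderiv ℝ a z w v := by
  have k : ∀ u u' : E, fderiv ℝ (fun z => a z u') z u = fderiv ℝ a z u u' := by
    intro u u'
    rw [fderiv_clm_apply hd (differentiableAt_const u')]
    simp
  have hd' : DifferentiableAt ℝ (fun z : E => ContinuousAlternatingMap.ofSubsingleton ℝ E W
      (0 : Fin 1) (a z)) z :=
    (ContinuousAlternatingMap.ofSubsingletonLIE (𝕜 := ℝ) (E := E) (F := W)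
      (0 : Fin 1)).differentiableAt.comp _ hd
  rw [extDeriv_apply hd', ← k, ← k, Fin.sum_univ_two]
  simp [sub_eq_add_neg, Fin.removeNth_apply]

theorem dForm_eq {A : ∀ x : M, TangentSpace 𝓘(ℝ, E) x →L[ℝ] W} {x : M}
    (h : SmoothForm1At A x) (v w : TangentSpace 𝓘(ℝ, E) x) :
    dForm A x v w = fderiv ℝ (chartForm A x) (extChartAt 𝓘(ℝ, E) x x) v w
      - fderiv ℝ (chartForm A x) (extChartAt 𝓘(ℝ, E) x x) w v := by
  have e := mfderiv_extChartAt_self (I := 𝓘(ℝ, E)) (x := x)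
  rw [dForm, e]
  exact extDeriv_ofSubsingleton_apply (h.contDiffAt_chartForm.differentiableAt (by simp)) v w

/-- The exterior derivative as a bilinear map. -/
def dFormL (A : ∀ x : M, TangentSpace 𝓘(ℝ, E) x →L[ℝ] W) (x : M) :
    TangentSpace 𝓘(ℝ, E) x →L[ℝ] TangentSpace 𝓘(ℝ, E) x →L[ℝ] W :=
  (fderiv ℝ (chartForm A x) (extChartAt 𝓘(ℝ, E) x x)
    - (fderiv ℝ (chartForm A x) (extChartAt 𝓘(ℝ, E) x x)).flip : E →L[ℝ] E →L[ℝ] W)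

theorem dFormL_apply {A : ∀ x : M, TangentSpace 𝓘(ℝ, E) x →L[ℝ] W} {x : M}
    (h : SmoothForm1At A x) (v w : TangentSpace 𝓘(ℝ, E) x) : dFormL A x v w = dForm A x v w :=
  (dForm_eq h v w).symm

/-- A constant linear map commutes with differentiation. Applied to the two projections and to
`ioL`, this splits the exterior derivative of `θ + e` into those of its components. -/
theorem dForm_clm_comp {A : ∀ x : M, TangentSpace 𝓘(ℝ, E) x →L[ℝ] W} {x : M}
    (L : W →L[ℝ] W') (h : SmoothForm1At A x) (h' : SmoothForm1At (fun y => L.comp (A y)) x)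
    (v w : TangentSpace 𝓘(ℝ, E) x) :
    dForm (fun y => L.comp (A y)) x v w = L (dForm A x v w) := by
  have hd : DifferentiableAt ℝ (chartForm A x) (extChartAt 𝓘(ℝ, E) x x) :=
    h.contDiffAt_chartForm.differentiableAt (by simp)
  have e : chartForm (fun y => L.comp (A y)) x =
      fun z => (ContinuousLinearMap.compL ℝ E W W' L) (chartForm A x z) := rfl
  have e1 : fderiv ℝ (chartForm (fun y => L.comp (A y)) x) (extChartAt 𝓘(ℝ, E) x x) =
      (ContinuousLinearMap.compL ℝ E W W' L).comp
        (fderiv ℝ (chartForm A x) (extChartAt 𝓘(ℝ, E) x x)) := by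
    rw [e]
    exact ((ContinuousLinearMap.compL ℝ E W W' L).hasFDerivAt.comp _ hd.hasFDerivAt).fderiv
  rw [dForm_eq h, dForm_eq h', e1, map_sub]
  rfl

theorem dFun_eq {g : M → W} {x : M} (hg : ContMDiffAt 𝓘(ℝ, E) 𝓘(ℝ, W) ∞ g x)
    (v : TangentSpace 𝓘(ℝ, E) x) :
    dFun g x v =
      fderiv ℝ (fun z => g ((extChartAt 𝓘(ℝ, E) x).symm z)) (extChartAt 𝓘(ℝ, E) x x) v := by
  have h : MDifferentiableAt 𝓘(ℝ, E) 𝓘(ℝ, W) g x := hg.mdifferentiableAt (by simp)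
  have e := h.mfderiv
  rw [modelWithCornersSelf_coe, Set.range_id, fderivWithin_univ] at e
  exact DFunLike.congr_fun e v

theorem contDiffAt_comp_extChartAt_symm {g : M → W} {x : M}
    (hg : ContMDiffAt 𝓘(ℝ, E) 𝓘(ℝ, W) ∞ g x) :
    ContDiffAt ℝ ∞ (fun z => g ((extChartAt 𝓘(ℝ, E) x).symm z)) (extChartAt 𝓘(ℝ, E) x x) :=
  contMDiffAt_iff_contDiffAt.1 (ContMDiffAt.comp_of_eq hg
    (contMDiffAt_extChartAt_symm x (mem_extChartAt_target (I := 𝓘(ℝ, E)) x)) (extChartAt_to_inv x))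

/-- The pullback of `dg` to a chart is the derivative of the pullback of `g`. -/
theorem eventually_chartForm_dFun {g : M → W} {x : M}
    (hg : ContMDiffAt 𝓘(ℝ, E) 𝓘(ℝ, W) ∞ g x) :
    ∀ᶠ z in 𝓝 (extChartAt 𝓘(ℝ, E) x x), ∀ v : E,
      dFun g ((extChartAt 𝓘(ℝ, E) x).symm z)
        (mfderiv 𝓘(ℝ, E) 𝓘(ℝ, E) (extChartAt 𝓘(ℝ, E) x).symm z v) =
      fderiv ℝ (fun z => g ((extChartAt 𝓘(ℝ, E) x).symm z)) z v := by
  have h1 : ∀ᶠ y in 𝓝 x, ContMDiffAt 𝓘(ℝ, E) 𝓘(ℝ, W) 1 g y :=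
    (contMDiffAt_iff_contMDiffAt_nhds (by simp)).1 (hg.of_le (by simp))
  filter_upwards [eventually_extChartAt_symm h1, eventually_mem_target x] with z hz hz' v
  have := mfderiv_comp z (hz.mdifferentiableAt (by simp))
    ((contMDiffAt_extChartAt_symm x hz').mdifferentiableAt (by simp))
  rw [mfderiv_eq_fderiv] at this
  exact (DFunLike.congr_fun this v).symm

/-- The formula `dA(X, Y) = X (A(Y)) - Y (A(X)) - A([X, Y])`. -/
theorem dForm_apply_fields [CompleteSpace E] {A : ∀ x : M, TangentSpace 𝓘(ℝ, E) x →L[ℝ] W}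
    {x : M} (hA : SmoothForm1At A x) {X Y : ∀ y : M, TangentSpace 𝓘(ℝ, E) y}
    (hX : SmoothField X x) (hY : SmoothField Y x) :
    dForm A x (X x) (Y x) = dFun (fun y => A y (Y y)) x (X x) - dFun (fun y => A y (X y)) x (Y x)
      - A x (VectorField.mlieBracket 𝓘(ℝ, E) X Y x) := by
  set z₀ := extChartAt 𝓘(ℝ, E) x x with hz₀
  have hd : DifferentiableAt ℝ (chartForm A x) z₀ :=
    hA.contDiffAt_chartForm.differentiableAt (by simp)
  -- `P X` is the field `X` read in the chart around `x`; it has the same value at the base point,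
  -- and `A(X)` becomes the pairing of `chartForm A x` with it.
  let P : (∀ y : M, TangentSpace 𝓘(ℝ, E) y) → E → E := fun X z =>
    VectorField.mpullbackWithin 𝓘(ℝ, E) 𝓘(ℝ, E) (extChartAt 𝓘(ℝ, E) x).symm X Set.univ z
  have : IsManifold 𝓘(ℝ, E) 2 M := IsManifold.of_le (n := ∞) (by norm_cast)
  have hP : ∀ X, SmoothField X x → DifferentiableAt ℝ (P X) z₀ ∧ P X z₀ = X x ∧
      (∀ᶠ z in 𝓝 z₀, A ((extChartAt 𝓘(ℝ, E) x).symm z) (X ((extChartAt 𝓘(ℝ, E) x).symm z)) =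
        chartForm A x z (P X z)) := by
    intro X hX
    refine ⟨?_, ?_, ?_⟩
    · have h1 : MDifferentiableWithinAt 𝓘(ℝ, E) 𝓘(ℝ, E).tangent
          (fun y => (⟨y, X y⟩ : TangentBundle 𝓘(ℝ, E) M)) Set.univ x :=
        (ContMDiffAt.mdifferentiableAt hX (by simp)).mdifferentiableWithinAt
      have h2 := h1.differentiableWithinAt_mpullbackWithin_vectorField
      rw [modelWithCornersSelf_coe, Set.range_id, Set.preimage_univ, Set.univ_inter] at h2
      exact differentiableWithinAt_univ.1 h2
    · have k : ∀ (y : M) (hy : y = x), (X y : E) = X x := by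
        rintro y rfl
        rfl
      have h1 := mfderivWithin_extChartAt_symm_inverse_apply (I := 𝓘(ℝ, E)) (x := x) (X x)
      rw [modelWithCornersSelf_coe, Set.range_id] at h1
      exact (congrArg (mfderivWithin 𝓘(ℝ, E) 𝓘(ℝ, E) (extChartAt 𝓘(ℝ, E) x).symm Set.univ
        (extChartAt 𝓘(ℝ, E) x x)).inverse
        (k ((extChartAt 𝓘(ℝ, E) x).symm (extChartAt 𝓘(ℝ, E) x x)) (extChartAt_to_inv x))).trans h1
    · filter_upwards [eventually_mem_target x] with z hz
      obtain ⟨L, hL⟩ := isInvertible_mfderivWithin_extChartAt_symm (I := 𝓘(ℝ, E)) hz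
      rw [modelWithCornersSelf_coe, Set.range_id] at hL
      have h1 : P X z = L.symm (X ((extChartAt 𝓘(ℝ, E) x).symm z)) := by
        change (mfderivWithin 𝓘(ℝ, E) 𝓘(ℝ, E) (extChartAt 𝓘(ℝ, E) x).symm Set.univ z).inverse _ = _
        rw [← hL, ContinuousLinearMap.inverse_equiv]
        rfl
      rw [mfderivWithin_univ] at hL
      rw [h1, chartForm, ← hL]
      exact congrArg (A _) (L.apply_symm_apply _).symm
  -- The bracket on the manifold is the bracket in the chart, and the derivative of the chart at `x`
  -- is the identity.
  have hL : (VectorField.mlieBracket 𝓘(ℝ, E) X Y x : E) =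
      fderiv ℝ (P Y) z₀ (P X z₀) - fderiv ℝ (P X) z₀ (P Y z₀) := by
    rw [← VectorField.mlieBracketWithin_univ, VectorField.mlieBracketWithin_apply,
      mfderiv_extChartAt_self, modelWithCornersSelf_coe, Set.range_id, Set.preimage_univ,
      Set.univ_inter]
    refine (DFunLike.congr_fun (ContinuousLinearMap.inverse_id (R := ℝ) (M := E)) _).trans ?_
    exact congrFun (VectorField.lieBracketWithin_univ (V := P X) (W := P Y)) z₀
  -- Product rule in the chart: the derivative of `A` contributes to `dA`, that of the field to the
  -- bracket.
  have key : ∀ X Y, SmoothField X x → SmoothField Y x → dFun (fun y => A y (Y y)) x (X x) =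
      fderiv ℝ (chartForm A x) z₀ (X x) (Y x) + A x (fderiv ℝ (P Y) z₀ (X x) : E) := by
    intro X Y hX hY
    obtain ⟨h1, h2, h3⟩ := hP Y hY
    have hs : ContMDiffAt 𝓘(ℝ, E) 𝓘(ℝ, W) ∞ (fun y => A y (Y y)) x :=
      contMDiffAt_mk_trivial.1 (ContMDiffAt.clm_bundle_apply hA hY)
    rw [dFun_eq hs, ← hz₀, Filter.EventuallyEq.fderiv_eq h3, fderiv_clm_apply hd h1, h2]
    refine Eq.trans ?_ (congrArg _ (chartForm_self A x _))
    exact add_comm _ _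
  rw [key X Y hX hY, key Y X hY hX, dForm_eq hA, hL, (hP X hX).2.1, (hP Y hY).2.1]
  refine Eq.trans ?_ (congrArg _ (map_sub (A x) _ _).symm)
  abel

/-- Gauge covariance of the curvature. -/
theorem curvature_gaugeTransform {𝔸 : Type*} [NormedRing 𝔸] [NormedAlgebra ℝ 𝔸]
    {A B : ∀ x : M, TangentSpace 𝓘(ℝ, E) x →L[ℝ] 𝔸} {g g' : M → 𝔸} {x : M}
    (hA : SmoothForm1At A x) (hB : SmoothForm1At B x)
    (hg : ContMDiffAt 𝓘(ℝ, E) 𝓘(ℝ, 𝔸) ∞ g x) (hg' : ContMDiffAt 𝓘(ℝ, E) 𝓘(ℝ, 𝔸) ∞ g' x)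
    (h : ∀ᶠ y in 𝓝 x, g y * g' y = 1) (h' : ∀ᶠ y in 𝓝 x, g' y * g y = 1)
    (hAB : ∀ᶠ y in 𝓝 x, ∀ v, A y v = gaugeTransform g g' (B y) v)
    (v w : TangentSpace 𝓘(ℝ, E) x) :
    curvature A x v w = g x * curvature B x v w * g' x := by
  have := fderiv_gauge_sub_add_bracket ((contDiffAt_comp_extChartAt_symm hg).of_le
    (by norm_cast))
    ((contDiffAt_comp_extChartAt_symm hg').of_le (by norm_cast))
    (hB.contDiffAt_chartForm.differentiableAt (by simp)) (eventually_extChartAt_symm h)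
    (eventually_extChartAt_symm h') (a := chartForm A x) ?_ v w
  · rw [extChartAt_to_inv] at this
    rw [chartForm_self A x v, chartForm_self A x w, chartForm_self B x v,
      chartForm_self B x w] at this
    rw [curvature, curvature, dForm_eq hA, dForm_eq hB]
    exact this
  -- The gauge law survives the pullback to the chart because pullback commutes with the
  -- differential of a function.
  · filter_upwards [eventually_extChartAt_symm hAB, eventually_chartForm_dFun hg'] with z hz hz' v
    rw [← hz' v]
    exact hz _

end Charts

/-! ## Smooth maps to `IO(p,q)` -/

section SmoothIO

variable {p q : ℕ}

/-- The `𝔬(p,q)`-part of an affine matrix. -/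
def rotPart (p q : ℕ) : Aff p q →L[ℝ] EndR p q :=
  (ContinuousLinearMap.compL ℝ (Rpq p q) (Rpq p q × ℝ) (Rpq p q)
    (ContinuousLinearMap.fst ℝ (Rpq p q) ℝ)).comp
    ((ContinuousLinearMap.compL ℝ (Rpq p q) (Rpq p q × ℝ) (Rpq p q × ℝ)).flip
      (ContinuousLinearMap.inl ℝ (Rpq p q) ℝ))

/-- The translation part of an affine matrix. -/
def transPart (p q : ℕ) : Aff p q →L[ℝ] Rpq p q :=
  (ContinuousLinearMap.fst ℝ (Rpq p q) ℝ).comp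
    (ContinuousLinearMap.apply ℝ (Rpq p q × ℝ) ((0 : Rpq p q), (1 : ℝ)))

theorem rotPart_apply (X : Aff p q) (v : Rpq p q) : rotPart p q X v = (X (v, 0)).1 := rfl

theorem transPart_apply (X : Aff p q) : transPart p q X = (X (0, 1)).1 := rfl

@[simp] theorem rotPart_affMk (ξ : EndR p q) (u : Rpq p q) (c : ℝ) :
    rotPart p q (affMk ξ u c) = ξ := by
  refine ContinuousLinearMap.ext fun v => ?_
  simp [rotPart_apply]

@[simp] theorem transPart_affMk (ξ : EndR p q) (u : Rpq p q) (c : ℝ) :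
    transPart p q (affMk ξ u c) = u := by
  simp [transPart_apply]

@[simp] theorem rotPart_ioMk (ξ : EndR p q) (u : Rpq p q) : rotPart p q (ioMk ξ u) = ξ :=
  rotPart_affMk _ _ _

@[simp] theorem transPart_ioMk (ξ : EndR p q) (u : Rpq p q) : transPart p q (ioMk ξ u) = u :=
  transPart_affMk _ _ _

@[simp] theorem rotPart_mat (a : IOpq p q) : rotPart p q a.mat = a.rot.toEnd := rotPart_affMk _ _ _

@[simp] theorem transPart_mat (a : IOpq p q) : transPart p q a.mat = a.trans :=
  transPart_affMk _ _ _

theorem ioMk_rotPart_transPart {X : Aff p q} (hX : X ∈ io p q) :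
    ioMk (rotPart p q X) (transPart p q X) = X := by
  obtain ⟨ξ, -, u, rfl⟩ := hX
  simp

theorem ioMk_inj {ξ ξ' : EndR p q} {u u' : Rpq p q} :
    ioMk ξ u = ioMk ξ' u' ↔ ξ = ξ' ∧ u = u' := by
  refine ⟨fun h => ⟨?_, ?_⟩, fun h => by rw [h.1, h.2]⟩
  · simpa using congrArg (rotPart p q) h
  · simpa using congrArg (transPart p q) h

/-- The pair `(ξ, u)` as a matrix, as a continuous linear map. -/
def ioL (p q : ℕ) : EndR p q × Rpq p q →L[ℝ] Aff p q :=
  LinearMap.toContinuousLinearMap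
    { toFun := fun x => ioMk x.1 x.2
      map_add' := fun x y => ContinuousLinearMap.ext fun v => by
        simp [ioMk, add_add_add_comm]
      map_smul' := fun c x => ContinuousLinearMap.ext fun v => by
        simp [ioMk, smul_comm v.2 c] }

theorem ioL_apply (x : EndR p q × Rpq p q) : ioL p q x = ioMk x.1 x.2 := rfl

theorem affMk_eq (ξ : EndR p q) (u : Rpq p q) (c : ℝ) :
    affMk ξ u c = ioL p q (ξ, u) + affMk 0 0 c :=
  ContinuousLinearMap.ext fun v => by simp [ioL_apply, ioMk]

@[simp] theorem IOpq.mat_mul_mat_inv (a : IOpq p q) : a.mat * a⁻¹.mat = 1 := by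
  rw [← IOpq.mat_mul, mul_inv_cancel, IOpq.mat_one]

@[simp] theorem IOpq.mat_inv_mul_mat (a : IOpq p q) : a⁻¹.mat * a.mat = 1 := by
  rw [← IOpq.mat_mul, inv_mul_cancel, IOpq.mat_one]

/-- The unit of the algebra of affine matrices defined by an element of `IO(p,q)`. -/
def IOpq.unit (a : IOpq p q) : (Aff p q)ˣ := ⟨a.mat, a⁻¹.mat, by simp, by simp⟩

/-- The metric of `ℝ^{p,q}` as a continuous bilinear map. -/
def stdMetricL (p q : ℕ) : Rpq p q →L[ℝ] Rpq p q →L[ℝ] ℝ :=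
  LinearMap.toContinuousLinearMap
    { toFun := fun v => LinearMap.toContinuousLinearMap
        { toFun := fun w => stdMetric v w
          map_add' := fun w w' => by
            simp only [stdMetric, Pi.add_apply, mul_add, Finset.sum_add_distrib]
            ring
          map_smul' := fun c w => by
            simp [stdMetric, mul_sub, Finset.mul_sum, mul_left_comm] }
      map_add' := fun v v' => ContinuousLinearMap.ext fun w => by
        simp only [stdMetric, LinearMap.coe_toContinuousLinearMap', LinearMap.coe_mk,
          AddHom.coe_mk, add_apply, Pi.add_apply, add_mul, Finset.sum_add_distrib]
        ring
      map_smul' := fun c v => ContinuousLinearMap.ext fun w => by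
        simp [stdMetric, mul_sub, Finset.mul_sum, mul_assoc] }

variable {E : Type*} [NormedAddCommGroup E] [NormedSpace ℝ E]
  {M : Type*} [TopologicalSpace M] [ChartedSpace E M]

/-- The `IO(p,q)`-valued function `a` is smooth at `x`. -/
def SmoothIO (E : Type*) [NormedAddCommGroup E] [NormedSpace ℝ E]
    {M : Type*} [TopologicalSpace M] [ChartedSpace E M] (a : M → IOpq p q) (x : M) : Prop :=
  ContMDiffAt 𝓘(ℝ, E) 𝓘(ℝ, Aff p q) ∞ (fun y => (a y).mat) x

variable {a b : M → IOpq p q} {x : M}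

theorem SmoothIO.congr (ha : SmoothIO E a x) (h : ∀ᶠ y in 𝓝 x, b y = a y) : SmoothIO E b x :=
  ContMDiffAt.congr_of_eventuallyEq ha (h.mono fun y hy => by simp only [hy])

theorem contMDiffAt_mul {𝔸 : Type*} [NormedRing 𝔸] [NormedAlgebra ℝ 𝔸] {f g : M → 𝔸}
    (hf : ContMDiffAt 𝓘(ℝ, E) 𝓘(ℝ, 𝔸) ∞ f x) (hg : ContMDiffAt 𝓘(ℝ, E) 𝓘(ℝ, 𝔸) ∞ g x) :
    ContMDiffAt 𝓘(ℝ, E) 𝓘(ℝ, 𝔸) ∞ (fun y => f y * g y) x :=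
  (contDiff_mul.contMDiff.contMDiffAt (x := (f x, g x))).comp x (hf.prodMk_space hg)

theorem contMDiffAt_clm {W W' : Type*} [NormedAddCommGroup W] [NormedSpace ℝ W]
    [NormedAddCommGroup W'] [NormedSpace ℝ W'] (L : W →L[ℝ] W') {f : M → W}
    (hf : ContMDiffAt 𝓘(ℝ, E) 𝓘(ℝ, W) ∞ f x) :
    ContMDiffAt 𝓘(ℝ, E) 𝓘(ℝ, W') ∞ (fun y => L (f y)) x :=
  L.contMDiff.contMDiffAt.comp x hf

theorem SmoothIO.mul (ha : SmoothIO E a x) (hb : SmoothIO E b x) :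
    SmoothIO E (fun y => a y * b y) x := by
  have := contMDiffAt_mul ha hb
  simp_rw [← IOpq.mat_mul] at this
  exact this

/-- The affine matrix of `a` is a unit of a Banach algebra, where inversion is smooth; no charts on
the group enter. -/
theorem SmoothIO.inv (ha : SmoothIO E a x) : SmoothIO E (fun y => (a y)⁻¹) x := by
  have h : ContDiffAt ℝ ∞ Ring.inverse ((a x).unit : Aff p q) := contDiffAt_ringInverse ℝ _
  have h1 : ContMDiffAt 𝓘(ℝ, E) 𝓘(ℝ, Aff p q) ∞ (fun y => Ring.inverse ((a y).unit : Aff p q)) x :=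
    ContMDiffAt.comp x h.contMDiffAt ha
  simp_rw [Ring.inverse_unit] at h1
  exact h1

theorem SmoothIO.contMDiffAt_rot (ha : SmoothIO E a x) :
    ContMDiffAt 𝓘(ℝ, E) 𝓘(ℝ, EndR p q) ∞ (fun y => (a y).rot.toEnd) x := by
  have := contMDiffAt_clm (rotPart p q) ha
  simp_rw [rotPart_mat] at this
  exact this

theorem smoothIO_ofO {k : M → Opq p q}
    (hk : ContMDiffAt 𝓘(ℝ, E) 𝓘(ℝ, EndR p q) ∞ (fun y => (k y).toEnd) x) :
    SmoothIO E (fun y => IOpq.ofO p q (k y)) x := by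
  have h : (fun y => (IOpq.ofO p q (k y)).mat) =
      fun y => ioL p q ((k y).toEnd, 0) + affMk 0 0 1 :=
    funext fun y => affMk_eq _ _ _
  rw [SmoothIO, h]
  exact (contMDiffAt_clm _ (hk.prodMk_space contMDiffAt_const)).add contMDiffAt_const

/-- The Maurer-Cartan form of `O(p,q)` takes its values in the Lie algebra. -/
theorem toEnd_mul_dFun_inv_mem [IsManifold 𝓘(ℝ, E) ∞ M] {k : M → Opq p q}
    (hk : ContMDiffAt 𝓘(ℝ, E) 𝓘(ℝ, EndR p q) ∞ (fun y => (k y)⁻¹.toEnd) x)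
    (v : TangentSpace 𝓘(ℝ, E) x) :
    (k x).toEnd * dFun (fun y => (k y)⁻¹.toEnd) x v ∈ opq p q := by
  intro w w'
  have isom : ∀ (l : Opq p q) (u u' : Rpq p q), stdMetric (l.toEnd u) (l.toEnd u') = stdMetric u u' :=
    fun l u u' => l.2 u u'
  rw [dFun_eq hk]
  set z₀ := extChartAt 𝓘(ℝ, E) x x with hz₀
  set K : E → EndR p q := fun z => (k ((extChartAt 𝓘(ℝ, E) x).symm z))⁻¹.toEnd with hK
  have hKz : K z₀ = (k x)⁻¹.toEnd := by simp only [hK, hz₀, extChartAt_to_inv]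
  have hd : DifferentiableAt ℝ K z₀ :=
    (contDiffAt_comp_extChartAt_symm hk).differentiableAt (by simp)
  have h1 : ∀ u : Rpq p q, HasFDerivAt (fun z => K z u) ((fderiv ℝ K z₀).flip u) z₀ := fun u => by
    simpa using hd.hasFDerivAt.clm_apply (hasFDerivAt_const u z₀)
  -- With `K = k⁻¹`, the function `⟨K w, K w'⟩` is constant because `K` is isometric; its vanishing
  -- derivative is the defining equation of `𝔬(p,q)`, up to applying the isometry `k x` to both
  -- arguments.
  have h2 := (((stdMetricL p q).hasFDerivAt.comp z₀ (h1 w)).clm_apply (h1 w')).fderiv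
  have h3 : (fun z => stdMetricL p q (K z w) (K z w')) = fun _ => stdMetric w w' :=
    funext fun z => isom _ _ _
  have h4 : fderiv ℝ (fun z => stdMetricL p q (K z w) (K z w')) z₀ = 0 := by
    rw [h3, fderiv_const_apply]
  have h5 := DFunLike.congr_fun (h4.symm.trans h2) (v : E)
  generalize hD : fderiv ℝ K z₀ v = D
  have h6 : stdMetric (K z₀ w) (D w') + stdMetric (D w) (K z₀ w') = 0 := by
    rw [← hD]
    exact h5.symm
  rw [hKz] at h6
  have h7 := isom (k x) (D w) ((k x)⁻¹.toEnd w')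
  have h8 := isom (k x) ((k x)⁻¹.toEnd w) (D w')
  rw [Opq.toEnd_apply_inv] at h7 h8
  rw [mul_apply_eq_comp, mul_apply_eq_comp, h7, h8, add_comm]
  exact h6

/-- The differential of a smooth function is a smooth form. -/
theorem contMDiffAt_dFun_apply [FiniteDimensional ℝ E] [IsManifold 𝓘(ℝ, E) ∞ M]
    {W : Type*} [NormedAddCommGroup W] [NormedSpace ℝ W]
    {g : M → W} (hg : ContMDiffAt 𝓘(ℝ, E) 𝓘(ℝ, W) ∞ g x)
    {X : ∀ y : M, TangentSpace 𝓘(ℝ, E) y} (hX : SmoothField X x) :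
    ContMDiffAt 𝓘(ℝ, E) 𝓘(ℝ, W) ∞ (fun y => dFun g y (X y)) x := by
  have h : SmoothForm1At (E := E) (fun y => dFun g y) x := by
    rw [SmoothForm1At, contMDiffAt_hom_bundle]
    refine ⟨contMDiffAt_id, ?_⟩
    refine (hg.mfderiv_const (m := ∞) (by simp)).congr_of_eventuallyEq ?_
    refine Filter.Eventually.of_forall fun y => ContinuousLinearMap.ext fun v => ?_
    -- Both the trivial bundle and the tangent bundle of the vector space `W` are trivialized by
    -- identities, so the coordinate expressions agree.
    have t : ∀ (y : M) (u : W),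
        (trivializationAt W (Trivial M W) x).continuousLinearMapAt ℝ y u = u := fun y u =>
      DFunLike.congr_fun (Trivial.continuousLinearMapAt_trivialization ℝ M W y) u
    have t' : ∀ b' (u : W), (trivializationAt W (TangentSpace 𝓘(ℝ, W)) (g x)).continuousLinearMapAt
        ℝ b' u = u := fun b' u => DFunLike.congr_fun
          (TangentBundle.continuousLinearMapAt_model_space (𝕜 := ℝ) (g x) b') u
    exact (t _ _).trans (t' _ _).symm
  exact smoothForm1At_iff.1 h X hX

end SmoothIO

/-! ## Frames and the bundle of objects -/

section Frames

variable {p q : ℕ}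
  {E : Type*} [NormedAddCommGroup E] [NormedSpace ℝ E]
  {M : Type*} [TopologicalSpace M] [ChartedSpace E M] [IsManifold 𝓘(ℝ, E) ∞ M]
  {F : Type*} [NormedAddCommGroup F] [NormedSpace ℝ F]
  {V : M → Type*} [TopologicalSpace (TotalSpace F V)]
  [∀ x, AddCommGroup (V x)] [∀ x, Module ℝ (V x)] [∀ x, TopologicalSpace (V x)]
  [∀ x, IsTopologicalAddGroup (V x)] [∀ x, ContinuousSMul ℝ (V x)]
  [FiberBundle F V] [VectorBundle ℝ F V] [ContMDiffVectorBundle ∞ F V 𝓘(ℝ, E)]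
  {T : FakeTangentBundle (E := E) p q F V} {x : M}

/-- The element of `O(p,q)` relating two frames at the same point. -/
def Frame.diff (f f' : Frame T x) : Opq p q :=
  ⟨f'.toEquiv.trans f.toEquiv.symm, fun v w => by
    rw [← f.isometry, ← f'.isometry]
    simp⟩

theorem Frame.act_diff (f f' : Frame T x) : f.act (f.diff f') = f' :=
  Frame.ext (ContinuousLinearEquiv.ext (funext fun v => f.toEquiv.apply_symm_apply (f'.toEquiv v)))

theorem Frame.act_injective (f : Frame T x) {k k' : Opq p q} (h : f.act k = f.act k') : k = k' := by
  refine Subtype.ext (ContinuousLinearEquiv.ext (funext fun v => f.toEquiv.injective ?_))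
  exact congrArg (fun l : Frame T x => l.toEquiv v) h

theorem Frame.act_one (f : Frame T x) : f.act 1 = f := rfl

theorem Frame.act_act (f : Frame T x) (k k' : Opq p q) : (f.act k).act k' = f.act (k * k') := rfl

theorem Frame.inv_diff (f f' : Frame T x) : (f.diff f')⁻¹ = f'.diff f := by
  refine f'.act_injective ?_
  rw [Frame.act_diff]
  refine Eq.trans ?_ (f.act_one)
  rw [← mul_inv_cancel (f.diff f'), ← Frame.act_act, Frame.act_diff]

/-- The class `[f, a]`, as an object of the teleparallel 2-bundle. -/
def TelBundleObj.mk (f : Frame T x) (a : IOpq p q) : TelBundleObj T x := Assoc.mk f a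

theorem TelBundleObj.mk_eq_mk {f f' : Frame T x} {a a' : IOpq p q} :
    TelBundleObj.mk f a = TelBundleObj.mk f' a' ↔
      ∃ k : Opq p q, f = f'.act k ∧ k • a = a' :=
  ⟨fun h => Quotient.exact h, fun h => Quotient.sound h⟩

theorem TelBundleObj.mk_act_left (f : Frame T x) (k : Opq p q) (a : IOpq p q) :
    TelBundleObj.mk (f.act k) a = TelBundleObj.mk f (IOpq.ofO p q k * a) :=
  TelBundleObj.mk_eq_mk.2 ⟨k, rfl, rfl⟩

/-- The action of `O(p,q)` on frames is free, so an equivalence that fixes the frame is given by `k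
= 1`. -/
theorem TelBundleObj.mk_right_inj {f : Frame T x} {a a' : IOpq p q} :
    TelBundleObj.mk f a = TelBundleObj.mk f a' ↔ a = a' := by
  refine ⟨fun h => ?_, fun h => by rw [h]⟩
  obtain ⟨k, hk, rfl⟩ := TelBundleObj.mk_eq_mk.1 h
  rw [f.act_injective (f.act_one.trans hk).symm, one_smul]

/-! ### The objects over a point as a torsor under `IO(p,q)` -/

namespace TelBundleObj

/-- The frames at `x` form a single `O(p,q)`-orbit, so a change of frame can be absorbed into the
group component. -/
theorem exists_mk (f : Frame T x) (y : TelBundleObj T x) :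
    ∃ a : IOpq p q, y = TelBundleObj.mk f a := by
  obtain ⟨⟨f', a⟩, rfl⟩ := Quotient.exists_rep y
  refine ⟨IOpq.ofO p q (f.diff f') * a, ?_⟩
  rw [← TelBundleObj.mk_act_left, Frame.act_diff]
  rfl

theorem mk_act (f : Frame T x) (a b : IOpq p q) :
    (TelBundleObj.mk f a).act b = TelBundleObj.mk f (a * b) := rfl

theorem exists_frame (y : TelBundleObj T x) :
    ∃ (f : Frame T x) (a : IOpq p q), y = TelBundleObj.mk f a := by
  obtain ⟨⟨f, a⟩, rfl⟩ := Quotient.exists_rep y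
  exact ⟨f, a, rfl⟩

theorem act_act (y : TelBundleObj T x) (a b : IOpq p q) : (y.act a).act b = y.act (a * b) := by
  obtain ⟨f, c, rfl⟩ := y.exists_frame
  simp only [mk_act, mul_assoc]

theorem act_one (y : TelBundleObj T x) : y.act 1 = y := by
  obtain ⟨f, c, rfl⟩ := y.exists_frame
  rw [mk_act, mul_one]

theorem act_right_inj {y : TelBundleObj T x} {a b : IOpq p q} : y.act a = y.act b ↔ a = b := by
  obtain ⟨f, c, rfl⟩ := y.exists_frame
  rw [mk_act, mk_act, TelBundleObj.mk_right_inj, mul_right_inj]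

theorem exists_act_eq (y y' : TelBundleObj T x) : ∃ a : IOpq p q, y.act a = y' := by
  obtain ⟨f, c, rfl⟩ := y.exists_frame
  obtain ⟨c', rfl⟩ := exists_mk f y'
  exact ⟨c⁻¹ * c', by rw [mk_act, mul_inv_cancel_left]⟩

/-- The element of `IO(p,q)` relating two objects of the teleparallel 2-bundle over the same
point. -/
def diff (y y' : TelBundleObj T x) : IOpq p q := (exists_act_eq y y').choose

@[simp] theorem act_diff (y y' : TelBundleObj T x) : y.act (y.diff y') = y' :=
  (exists_act_eq y y').choose_spec

/-- Since the action is free, the element chosen in `diff` is determined by its effect on `y`; this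
is how the identities for `diff` are verified. -/
theorem diff_eq_of_act_eq {y y' : TelBundleObj T x} {a : IOpq p q} (h : y.act a = y') :
    y.diff y' = a :=
  act_right_inj.1 ((act_diff y y').trans h.symm)

theorem diff_mul_diff (y y' y'' : TelBundleObj T x) :
    y.diff y' * y'.diff y'' = y.diff y'' :=
  (diff_eq_of_act_eq (by rw [← act_act, act_diff, act_diff])).symm

@[simp] theorem diff_self (y : TelBundleObj T x) : y.diff y = 1 := diff_eq_of_act_eq (act_one y)

theorem inv_diff (y y' : TelBundleObj T x) : (y.diff y')⁻¹ = y'.diff y := by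
  rw [inv_eq_iff_mul_eq_one, diff_mul_diff, diff_self]

theorem diff_mk (f : Frame T x) (a b : IOpq p q) :
    diff (TelBundleObj.mk f a) (TelBundleObj.mk f b) = a⁻¹ * b :=
  diff_eq_of_act_eq (by rw [mk_act, mul_inv_cancel_left])

/-- The frame of `V x` underlying an object of the teleparallel 2-bundle over `x`. -/
def lin (y : TelBundleObj T x) : Rpq p q ≃L[ℝ] V x :=
  Quotient.lift (fun z : Frame T x × IOpq p q => (z.1.act z.2.rot).toEquiv) (by
    rintro ⟨f, a⟩ ⟨f', a'⟩ ⟨k, h1, h2⟩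
    dsimp only at h1 h2 ⊢
    rw [h1, ← h2]
    rfl) y

theorem lin_mk (f : Frame T x) (a : IOpq p q) (v : Rpq p q) :
    lin (TelBundleObj.mk f a) v = f.toEquiv (a.rot.toEnd v) := rfl

theorem lin_act (y : TelBundleObj T x) (a : IOpq p q) (v : Rpq p q) :
    (y.act a).lin v = y.lin (a.rot.toEnd v) := by
  obtain ⟨f, c, rfl⟩ := y.exists_frame
  rw [mk_act, lin_mk, lin_mk, IOpq.mul_rot, Opq.toEnd_mul]

theorem lin_diff (y y' : TelBundleObj T x) (v : Rpq p q) :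
    y.lin ((y.diff y').rot.toEnd v) = y'.lin v := by
  rw [← lin_act, act_diff]

end TelBundleObj

/-- The objects of the teleparallel 2-bundle defined by a local frame. -/
def LocalFrame.obj (s : LocalFrame T) (x : M) : TelBundleObj T x := TelBundleObj.mk (s.s x) 1

theorem LocalFrame.lin_obj (s : LocalFrame T) (x : M) (v : Rpq p q) :
    (s.obj x).lin v = (s.s x).toEquiv v := rfl

theorem LocalFrame.diff_mk (s : LocalFrame T) (x : M) (a : IOpq p q) :
    (s.obj x).diff (TelBundleObj.mk (s.s x) a) = a := by
  rw [LocalFrame.obj, TelBundleObj.diff_mk, inv_one, one_mul]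

/-- Transitions between frames have no translation part. For this reason the `𝔬(p,q)`- and
`ℝ^{p,q}`-components of a local form transform separately. -/
theorem LocalFrame.diff_obj (s s' : LocalFrame T) (x : M) :
    (s.obj x).diff (s'.obj x) = IOpq.ofO p q ((s.s x).diff (s'.s x)) := by
  refine TelBundleObj.diff_eq_of_act_eq ?_
  rw [LocalFrame.obj, LocalFrame.obj, TelBundleObj.mk_act, one_mul,
    ← mul_one (IOpq.ofO p q _), ← TelBundleObj.mk_act_left, Frame.act_diff]

/-! ### Smoothness -/

section Smooth

variable [FiniteDimensional ℝ F]

/-- In a trivialization of `V` the frame becomes a function `L` with invertible values, smooth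
because its evaluations are. Inversion of operators is smooth, so coordinates in the trivialization
and coordinates in the frame determine each other smoothly. -/
theorem LocalFrame.contMDiffAt_section_iff (s : LocalFrame T) (hx : x ∈ s.U) {σ : ∀ y, V y} :
    ContMDiffAt 𝓘(ℝ, E) (𝓘(ℝ, E).prod 𝓘(ℝ, F)) ∞
      (fun y => (TotalSpace.mk' F y (σ y) : TotalSpace F V)) x ↔
    ContMDiffAt 𝓘(ℝ, E) 𝓘(ℝ, Rpq p q) ∞ (fun y => (s.s y).toEquiv.symm (σ y)) x := by
  set e := trivializationAt F V x with he
  let L : M → Rpq p q →L[ℝ] F := fun y =>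
    (e.continuousLinearMapAt ℝ y).comp ((s.s y).toEquiv : Rpq p q →L[ℝ] V y)
  have hbase : ∀ᶠ y in 𝓝 x, y ∈ e.baseSet :=
    e.open_baseSet.mem_nhds (mem_baseSet_trivializationAt F V x)
  have hLs : ContMDiffAt 𝓘(ℝ, E) 𝓘(ℝ, Rpq p q →L[ℝ] F) ∞ L x := by
    refine contMDiffAt_clm_of_apply fun v => ?_
    have := (contMDiffAt_totalSpace.1
      ((s.smooth v x hx).contMDiffAt (s.U.isOpen.mem_nhds hx))).2
    refine this.congr_of_eventuallyEq ?_
    filter_upwards [hbase] with y hy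
    change e.continuousLinearMapAt ℝ y _ = _
    rw [e.continuousLinearMapAt_apply ℝ, e.coe_linearMapAt_of_mem hy]
    rfl
  -- `L y` as an isomorphism, available only over the base set; there `(L y).inverse` is a true
  -- inverse.
  let Le : ∀ y, y ∈ e.baseSet → (Rpq p q ≃L[ℝ] F) := fun y hy =>
    (s.s y).toEquiv.trans (e.continuousLinearEquivAt ℝ y hy)
  have hLe : ∀ y (hy : y ∈ e.baseSet), (Le y hy : Rpq p q →L[ℝ] F) = L y := fun y hy =>
    ContinuousLinearMap.ext fun v => by
      change e.continuousLinearEquivAt ℝ y hy _ = e.continuousLinearMapAt ℝ y _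
      rw [e.continuousLinearMapAt_apply ℝ, e.coe_linearMapAt_of_mem hy]
      rfl
  have hx0 := hbase.self_of_nhds
  have hinv : ContMDiffAt 𝓘(ℝ, E) 𝓘(ℝ, F →L[ℝ] Rpq p q) ∞
      (fun y => (L y).inverse) x := by
    have h := contDiffAt_map_inverse (n := ∞) (Le x hx0)
    rw [hLe] at h
    exact ContMDiffAt.comp x h.contMDiffAt hLs
  constructor
  · intro h
    have h1 := (contMDiffAt_totalSpace.1 h).2
    refine (hinv.clm_apply h1).congr_of_eventuallyEq ?_
    filter_upwards [hbase] with y hy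
    rw [← hLe y hy, ContinuousLinearMap.inverse_equiv]
    refine ((Le y hy).symm_apply_apply _).symm.trans ?_
    refine congrArg (Le y hy).symm ?_
    change e.continuousLinearEquivAt ℝ y hy ((s.s y).toEquiv _) = _
    rw [ContinuousLinearEquiv.apply_symm_apply]
    rfl
  · intro h
    refine contMDiffAt_totalSpace.2 ⟨contMDiffAt_id, ?_⟩
    refine (hLs.clm_apply h).congr_of_eventuallyEq ?_
    filter_upwards [hbase] with y hy
    change _ = e.continuousLinearMapAt ℝ y ((s.s y).toEquiv _)
    rw [ContinuousLinearEquiv.apply_symm_apply, e.continuousLinearMapAt_apply ℝ,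
      e.coe_linearMapAt_of_mem hy]

theorem LocalFrame.contMDiffAt_change (s s' : LocalFrame T) (hx : x ∈ s.U) (hx' : x ∈ s'.U) :
    ContMDiffAt 𝓘(ℝ, E) 𝓘(ℝ, EndR p q) ∞ (fun y => (s.s y).change (s'.s y)) x :=
  contMDiffAt_clm_of_apply fun v => (s.contMDiffAt_section_iff hx).1
    ((s'.smooth v x hx').contMDiffAt (s'.U.isOpen.mem_nhds hx'))

/-- The section `σ` of the bundle of objects is smooth at `x`. -/
def SmoothObj (σ : ∀ x, TelBundleObj T x) (x : M) : Prop :=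
  ∃ s : LocalFrame T, x ∈ s.U ∧ SmoothIO E (fun y => (s.obj y).diff (σ y)) x

theorem LocalFrame.smoothIO_diff (s s' : LocalFrame T) (hx : x ∈ s.U) (hx' : x ∈ s'.U) :
    SmoothIO E (fun y => (s.obj y).diff (s'.obj y)) x := by
  simp_rw [LocalFrame.diff_obj]
  exact smoothIO_ofO (s.contMDiffAt_change s' hx hx')

theorem LocalFrame.smoothObj (s : LocalFrame T) (hx : x ∈ s.U) : SmoothObj s.obj x :=
  ⟨s, hx, s.smoothIO_diff s hx hx⟩

/-- By the cocycle identity the difference factors through the two reference frames, whose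
transition is smooth. -/
theorem SmoothObj.smoothIO_diff {σ σ' : ∀ x, TelBundleObj T x} (h : SmoothObj σ x)
    (h' : SmoothObj σ' x) : SmoothIO E (fun y => (σ y).diff (σ' y)) x := by
  obtain ⟨s, hs, h⟩ := h
  obtain ⟨s', hs', h'⟩ := h'
  have := (h.inv.mul (s.smoothIO_diff s' hs hs')).mul h'
  simpa only [TelBundleObj.inv_diff, TelBundleObj.diff_mul_diff] using this

theorem SmoothObj.contMDiffAt_section_iff {σ : ∀ x, TelBundleObj T x} (h : SmoothObj σ x)
    {u : ∀ y, V y} :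
    ContMDiffAt 𝓘(ℝ, E) (𝓘(ℝ, E).prod 𝓘(ℝ, F)) ∞
      (fun y => (TotalSpace.mk' F y (u y) : TotalSpace F V)) x ↔
    ContMDiffAt 𝓘(ℝ, E) 𝓘(ℝ, Rpq p q) ∞ (fun y => (σ y).lin.symm (u y)) x := by
  obtain ⟨s, hs, h⟩ := h
  have h' := h.inv.contMDiffAt_rot
  have e : ∀ y, (σ y).lin.symm (u y) =
      (((s.obj y).diff (σ y))⁻¹).rot.toEnd ((s.s y).toEquiv.symm (u y)) := by
    intro y
    rw [ContinuousLinearEquiv.symm_apply_eq, TelBundleObj.inv_diff, TelBundleObj.lin_diff,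
      LocalFrame.lin_obj, ContinuousLinearEquiv.apply_symm_apply]
  rw [s.contMDiffAt_section_iff hs]
  refine ⟨fun hu => ?_, fun hu => ?_⟩
  · simp_rw [e]
    exact h'.clm_apply hu
  · refine (h.contMDiffAt_rot.clm_apply hu).congr_of_eventuallyEq (.of_forall fun y => ?_)
    dsimp only
    rw [e, IOpq.inv_rot, Opq.toEnd_apply_inv]

end Smooth

/-! ### Local trivializations -/

/-- The objects `(x, 1)` in a local trivialization. -/
def LocalTriv.unitObj (t : LocalTriv T) (x : M) : TelBundleObj T x := t.obj x 1

theorem LocalTriv.smoothObj [FiniteDimensional ℝ F] (t : LocalTriv T) (hx : x ∈ t.U) :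
    SmoothObj t.unitObj x := by
  obtain ⟨s, a, hs, -, ha, hsa⟩ := t.smooth x hx
  refine ⟨s, hs, SmoothIO.congr (ha.contMDiffAt (s.U.isOpen.mem_nhds hs)) ?_⟩
  filter_upwards [s.U.isOpen.mem_nhds hs] with y hy
  rw [LocalTriv.unitObj, hsa y hy]
  exact s.diff_mk y (a y)

/-- Equivariance of the trivialization turns the transition function into a torsor difference, so
that the cocycle calculus of `diff` applies. -/
theorem LocalTriv.transition_eq (t t' : LocalTriv T) (hx : x ∈ t.U) :
    t.transition t' x = (t.unitObj x).diff (t'.unitObj x) := by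
  refine (TelBundleObj.diff_eq_of_act_eq ?_).symm
  rw [LocalTriv.unitObj, ← t.obj_mul x hx, one_mul, LocalTriv.transition, Equiv.apply_symm_apply]
  rfl

theorem LocalTriv.exists_localFrame (t : LocalTriv T) (hx : x ∈ t.U) :
    ∃ s : LocalFrame T, x ∈ s.U := by
  obtain ⟨s, -, hs, -⟩ := t.smooth x hx
  exact ⟨s, hs⟩

end Frames

/-! ## Gauge transformations with values in `IO(p,q)` -/

section Gauge

variable {p q : ℕ}
  {E : Type*} [NormedAddCommGroup E] [NormedSpace ℝ E]
  {M : Type*} [TopologicalSpace M] [ChartedSpace E M] [IsManifold 𝓘(ℝ, E) ∞ M] {x : M}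

/-! ### Rules for the differential of a vector-valued function -/

section DFun

variable {W W' : Type*} [NormedAddCommGroup W] [NormedSpace ℝ W]
  [NormedAddCommGroup W'] [NormedSpace ℝ W']
  {𝔸 : Type*} [NormedRing 𝔸] [NormedAlgebra ℝ 𝔸]

theorem dFun_const (c : W) : dFun (E := E) (fun _ : M => c) x = 0 := mfderiv_const

theorem dFun_congr {f g : M → W} (h : ∀ᶠ y in 𝓝 x, f y = g y) :
    dFun (E := E) f x = dFun g x :=
  DFunLike.ext _ _ fun v => DFunLike.congr_fun
    (Filter.EventuallyEq.mfderiv_eq (I := 𝓘(ℝ, E)) (I' := 𝓘(ℝ, W)) (f₁ := f) (f := g) h) v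

theorem dFun_clm (L : W →L[ℝ] W') {f : M → W} (hf : ContMDiffAt 𝓘(ℝ, E) 𝓘(ℝ, W) ∞ f x)
    (v : TangentSpace 𝓘(ℝ, E) x) : dFun (fun y => L (f y)) x v = L (dFun f x v) := by
  rw [dFun_eq (contMDiffAt_clm L hf), dFun_eq hf]
  exact DFunLike.congr_fun (L.hasFDerivAt.comp _
    ((contDiffAt_comp_extChartAt_symm hf).differentiableAt (by simp)).hasFDerivAt).fderiv v

theorem dFun_add_const {f : M → W} (hf : ContMDiffAt 𝓘(ℝ, E) 𝓘(ℝ, W) ∞ f x) (c : W)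
    (v : TangentSpace 𝓘(ℝ, E) x) : dFun (fun y => f y + c) x v = dFun f x v := by
  have h : ContMDiffAt 𝓘(ℝ, E) 𝓘(ℝ, W) ∞ (fun y => f y + c) x := hf.add contMDiffAt_const
  rw [dFun_eq h, dFun_eq hf, fderiv_add_const]

theorem dFun_mul {f g : M → 𝔸} (hf : ContMDiffAt 𝓘(ℝ, E) 𝓘(ℝ, 𝔸) ∞ f x)
    (hg : ContMDiffAt 𝓘(ℝ, E) 𝓘(ℝ, 𝔸) ∞ g x) (v : TangentSpace 𝓘(ℝ, E) x) :
    dFun (fun y => f y * g y) x v = f x * dFun g x v + dFun f x v * g x := by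
  rw [dFun_eq (contMDiffAt_mul hf hg), dFun_eq hf, dFun_eq hg]
  have h := (((contDiffAt_comp_extChartAt_symm hf).differentiableAt (by simp)).hasFDerivAt.mul'
    ((contDiffAt_comp_extChartAt_symm hg).differentiableAt (by simp)).hasFDerivAt).fderiv
  refine (DFunLike.congr_fun h v).trans ?_
  rw [extChartAt_to_inv]
  rfl

end DFun

theorem affMk_mul_affMk (ξ ξ' : EndR p q) (u u' : Rpq p q) (c c' : ℝ) :
    affMk ξ u c * affMk ξ' u' c' = affMk (ξ * ξ') (ξ u' + c' • u) (c * c') := by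
  refine ContinuousLinearMap.ext fun v => ?_
  rw [mul_apply_eq_comp, affMk_apply, affMk_apply, affMk_apply, mul_apply_eq_comp]
  simp only [map_add, map_smul, smul_add, smul_smul, mul_assoc]
  rw [mul_comm c' v.2, add_assoc]

theorem IOpq.mat_mul_ioMk (a : IOpq p q) (ξ : EndR p q) (u : Rpq p q) :
    a.mat * ioMk ξ u = ioMk (a.rot.toEnd * ξ) (a.rot.toEnd u) := by
  rw [IOpq.mat, ioMk, affMk_mul_affMk, zero_smul, add_zero, mul_zero, ioMk]

theorem ioMk_mul_mat (a : IOpq p q) (ξ : EndR p q) (u : Rpq p q) :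
    ioMk ξ u * a.mat = ioMk (ξ * a.rot.toEnd) (ξ a.trans + u) := by
  rw [IOpq.mat, ioMk, affMk_mul_affMk, one_smul, zero_mul, ioMk]

theorem ioMk_add (ξ ξ' : EndR p q) (u u' : Rpq p q) :
    ioMk ξ u + ioMk ξ' u' = ioMk (ξ + ξ') (u + u') :=
  ((ioL p q).map_add (ξ, u) (ξ', u')).symm

/-- The affine matrix is a linear function of its rotation and translation parts plus a constant,
and differentiation removes the constant corner entry. -/
theorem dFun_mat {a : M → IOpq p q} (ha : SmoothIO E a x) (v : TangentSpace 𝓘(ℝ, E) x) :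
    dFun (fun y => (a y).mat) x v =
      ioMk (dFun (fun y => (a y).rot.toEnd) x v) (dFun (fun y => (a y).trans) x v) := by
  have h1 : (fun y => (a y).mat) =
      fun y => (ioL p q).comp ((rotPart p q).prod (transPart p q)) (a y).mat + affMk 0 0 1 :=
    funext fun y => by
      conv_lhs => rw [IOpq.mat, affMk_eq]
      simp
  have h2 := dFun_clm (rotPart p q) ha v
  have h3 := dFun_clm (transPart p q) ha v
  simp_rw [rotPart_mat] at h2
  simp_rw [transPart_mat] at h3
  conv_lhs => rw [h1]
  rw [dFun_add_const (contMDiffAt_clm _ ha), dFun_clm _ ha, h2, h3]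
  rfl

theorem toEnd_mul_mul_toEnd_inv_mem (k : Opq p q) {ξ : EndR p q} (hξ : ξ ∈ opq p q) :
    k.toEnd * ξ * k⁻¹.toEnd ∈ opq p q := by
  intro v w
  have isom : ∀ u u' : Rpq p q, stdMetric (k.toEnd u) (k.toEnd u') = stdMetric u u' :=
    fun u u' => k.2 u u'
  have h := hξ (k⁻¹.toEnd v) (k⁻¹.toEnd w)
  rw [← isom _ (k⁻¹.toEnd w), ← isom (k⁻¹.toEnd v), Opq.toEnd_apply_inv, Opq.toEnd_apply_inv] at h
  exact h

theorem ioMk_mem {ξ : EndR p q} (hξ : ξ ∈ opq p q) (u : Rpq p q) : ioMk ξ u ∈ io p q :=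
  ⟨ξ, hξ, u, rfl⟩

theorem add_mem_io {X Y : Aff p q} (hX : X ∈ io p q) (hY : Y ∈ io p q) : X + Y ∈ io p q := by
  obtain ⟨ξ, hξ, u, rfl⟩ := hX
  obtain ⟨ξ', hξ', u', rfl⟩ := hY
  rw [ioMk_add]
  exact ioMk_mem (add_mem hξ hξ') _

theorem zero_mem_io : (0 : Aff p q) ∈ io p q :=
  ⟨0, zero_mem _, 0, ((ioL p q).map_zero).symm⟩

theorem rotPart_mem {X : Aff p q} (hX : X ∈ io p q) : rotPart p q X ∈ opq p q := by
  obtain ⟨ξ, hξ, u, rfl⟩ := hX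
  rwa [rotPart_ioMk]

/-- The translation part mixes in `ξ`, through the translation part of `a⁻¹`. It reduces to `a.rot
u` when `a` has no translation or when `ξ = 0`, the two situations in which torsions are compared.
-/
theorem IOpq.conj_ioMk (a : IOpq p q) (ξ : EndR p q) (u : Rpq p q) :
    a.mat * ioMk ξ u * a⁻¹.mat = ioMk (a.rot.toEnd * ξ * a.rot⁻¹.toEnd)
      (a.rot.toEnd (u - ξ (a.rot⁻¹.toEnd a.trans))) := by
  rw [IOpq.mat_mul_ioMk, ioMk_mul_mat]
  congr 1
  rw [IOpq.inv_trans, mul_apply_eq_comp, map_neg, map_neg, map_sub]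
  abel

/-- The gauge transform `g A g⁻¹ + g dg⁻¹`, as a linear map. -/
def gauge (g : M → IOpq p q) {x : M} (A : TangentSpace 𝓘(ℝ, E) x →L[ℝ] Aff p q) :
    TangentSpace 𝓘(ℝ, E) x →L[ℝ] Aff p q :=
  (ContinuousLinearMap.mul ℝ (Aff p q) (g x).mat).comp
      (((ContinuousLinearMap.mul ℝ (Aff p q)).flip (g x)⁻¹.mat).comp A)
    + (ContinuousLinearMap.mul ℝ (Aff p q) (g x).mat).comp (dFun (fun y => (g y)⁻¹.mat) x)

variable {g h : M → IOpq p q} {A : TangentSpace 𝓘(ℝ, E) x →L[ℝ] Aff p q}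

theorem gauge_apply (g : M → IOpq p q) (A : TangentSpace 𝓘(ℝ, E) x →L[ℝ] Aff p q)
    (v : TangentSpace 𝓘(ℝ, E) x) :
    gauge g A v = gaugeTransform (fun y => (g y).mat) (fun y => (g y)⁻¹.mat) A v := by
  rw [gaugeTransform, mul_assoc]
  rfl

theorem gauge_eq (g : M → IOpq p q) (A : TangentSpace 𝓘(ℝ, E) x →L[ℝ] Aff p q)
    (v : TangentSpace 𝓘(ℝ, E) x) :
    gauge g A v = (g x).mat * A v * (g x)⁻¹.mat + (g x).mat * dFun (fun y => (g y)⁻¹.mat) x v :=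
  gauge_apply g A v

theorem gauge_congr (e : ∀ᶠ y in 𝓝 x, g y = h y) : gauge g A = gauge h A := by
  have e' : ∀ᶠ y in 𝓝 x, (g y)⁻¹.mat = (h y)⁻¹.mat := e.mono fun y hy => by rw [hy]
  rw [gauge, gauge, dFun_congr e', e.self_of_nhds]

theorem gauge_one : gauge (fun _ => (1 : IOpq p q)) A = A := by
  refine DFunLike.ext _ _ fun v => ?_
  rw [gauge_eq, dFun_const, inv_one, IOpq.mat_one, one_mul, mul_one, one_mul]
  exact add_zero _

/-- The product rule for `h⁻¹ g⁻¹` produces the two inhomogeneous terms, one of them after `h h⁻¹`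
cancels. All gluing arguments rest on this composition law. -/
theorem gauge_mul (hg : SmoothIO E g x) (hh : SmoothIO E h x) :
    gauge (fun y => g y * h y) A = gauge g (gauge h A) := by
  refine DFunLike.ext _ _ fun v => ?_
  have e : (fun y => (g y * h y)⁻¹.mat) = fun y => (h y)⁻¹.mat * (g y)⁻¹.mat :=
    funext fun y => by rw [mul_inv_rev, IOpq.mat_mul]
  rw [gauge_eq, gauge_eq, gauge_eq, e, dFun_mul hh.inv hg.inv, mul_inv_rev, IOpq.mat_mul,
    IOpq.mat_mul]
  have c : ∀ X, (h x).mat * ((h x)⁻¹.mat * X) = X := fun X => by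
    rw [← mul_assoc, IOpq.mat_mul_mat_inv, one_mul]
  simp only [mul_add, add_mul, mul_assoc, c]
  abel

/-- Conjugation preserves `𝔬(p,q)`, and the rotation part of the inhomogeneous term is a
Maurer-Cartan form; translation parts are unrestricted. -/
theorem gauge_mem_io (hg : SmoothIO E g x) {v : TangentSpace 𝓘(ℝ, E) x} (hA : A v ∈ io p q) :
    gauge g A v ∈ io p q := by
  rw [gauge_eq]
  refine add_mem_io ?_ ?_
  · obtain ⟨ξ, hξ, u, hu⟩ := hA
    rw [hu, IOpq.conj_ioMk]
    exact ioMk_mem (toEnd_mul_mul_toEnd_inv_mem _ hξ) _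
  · rw [dFun_mat hg.inv, IOpq.mat_mul_ioMk]
    exact ioMk_mem (toEnd_mul_dFun_inv_mem hg.inv.contMDiffAt_rot v) _

theorem SmoothForm1At.gauge [FiniteDimensional ℝ E]
    {A : ∀ x : M, TangentSpace 𝓘(ℝ, E) x →L[ℝ] Aff p q}
    (hA : SmoothForm1At A x) (hg : SmoothIO E g x) :
    SmoothForm1At (fun y => gauge g (A y)) x := by
  refine smoothForm1At_iff.2 fun X hX => ?_
  simp_rw [gauge_eq]
  exact (contMDiffAt_mul (contMDiffAt_mul hg (smoothForm1At_iff.1 hA X hX)) hg.inv).add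
    (contMDiffAt_mul hg (contMDiffAt_dFun_apply hg.inv hX))

theorem curvature_gauge {A B : ∀ x : M, TangentSpace 𝓘(ℝ, E) x →L[ℝ] Aff p q}
    (hA : SmoothForm1At A x) (hB : SmoothForm1At B x) (hg : SmoothIO E g x)
    (hAB : ∀ᶠ y in 𝓝 x, A y = gauge g (B y)) (v w : TangentSpace 𝓘(ℝ, E) x) :
    curvature A x v w = (g x).mat * curvature B x v w * (g x)⁻¹.mat :=
  curvature_gaugeTransform hA hB hg hg.inv (.of_forall fun y => by simp)
    (.of_forall fun y => by simp) (hAB.mono fun y hy v => by rw [hy, gauge_apply]) v w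

end Gauge

/-! ## Connections on the bundle of objects -/

section Extension

variable {p q : ℕ}
  {E : Type*} [NormedAddCommGroup E] [NormedSpace ℝ E]
  {M : Type*} [TopologicalSpace M] [ChartedSpace E M] [IsManifold 𝓘(ℝ, E) ∞ M]
  {F : Type*} [NormedAddCommGroup F] [NormedSpace ℝ F] [FiniteDimensional ℝ F]
  {V : M → Type*} [TopologicalSpace (TotalSpace F V)]
  [∀ x, AddCommGroup (V x)] [∀ x, Module ℝ (V x)] [∀ x, TopologicalSpace (V x)]
  [∀ x, IsTopologicalAddGroup (V x)] [∀ x, ContinuousSMul ℝ (V x)]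
  [FiberBundle F V] [VectorBundle ℝ F V] [ContMDiffVectorBundle ∞ F V 𝓘(ℝ, E)]
  {T : FakeTangentBundle (E := E) p q F V} {x : M}

theorem gauge_diff_gauge_diff {σ₁ σ₂ σ₃ : ∀ x, TelBundleObj T x} (h₁ : SmoothObj σ₁ x)
    (h₂ : SmoothObj σ₂ x) (h₃ : SmoothObj σ₃ x)
    (A : TangentSpace 𝓘(ℝ, E) x →L[ℝ] Aff p q) :
    gauge (fun y => (σ₁ y).diff (σ₂ y)) (gauge (fun y => (σ₂ y).diff (σ₃ y)) A) =
      gauge (fun y => (σ₁ y).diff (σ₃ y)) A := by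
  rw [← gauge_mul (h₁.smoothIO_diff h₂) (h₂.smoothIO_diff h₃)]
  simp_rw [TelBundleObj.diff_mul_diff]

theorem eq_gauge_diff_comm {σ₁ σ₂ : ∀ x, TelBundleObj T x} (h₁ : SmoothObj σ₁ x)
    (h₂ : SmoothObj σ₂ x) {A B : TangentSpace 𝓘(ℝ, E) x →L[ℝ] Aff p q}
    (h : A = gauge (fun y => (σ₁ y).diff (σ₂ y)) B) :
    B = gauge (fun y => (σ₂ y).diff (σ₁ y)) A := by
  rw [h, gauge_diff_gauge_diff h₂ h₁ h₂]
  simp_rw [TelBundleObj.diff_self]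
  exact gauge_one.symm

variable {J : Type*} (U : J → Opens M) (σ : J → ∀ x, TelBundleObj T x)
  (A : J → ∀ x : M, TangentSpace 𝓘(ℝ, E) x →L[ℝ] Aff p q)

open Classical in
/-- The local form, with respect to the section `ρ` of the bundle of objects, of the connection on
the bundle of objects with local forms `A j` with respect to the sections `σ j`. -/
def extendForm (ρ : ∀ x, TelBundleObj T x) (x : M) : TangentSpace 𝓘(ℝ, E) x →L[ℝ] Aff p q :=
  if h : ∃ j, x ∈ U j then gauge (fun y => (ρ y).diff (σ h.choose y)) (A h.choose x) else 0

variable {U σ A}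

/-- The compatibility of the given forms makes the index chosen in `extendForm` irrelevant. The
result is used for two families: the local frames, to build the forms `A i`, and the
trivializations, to recover the forms in frames. -/
theorem extendForm_eq
    (hσ : ∀ j, ∀ x ∈ U j, SmoothObj (σ j) x)
    (hA : ∀ i j x, x ∈ U i → x ∈ U j → A i x = gauge (fun y => (σ i y).diff (σ j y)) (A j x))
    {ρ : ∀ x, TelBundleObj T x} (hρ : SmoothObj ρ x) {j : J} (hx : x ∈ U j) :
    extendForm U σ A ρ x = gauge (fun y => (ρ y).diff (σ j y)) (A j x) := by
  have h : ∃ j, x ∈ U j := ⟨j, hx⟩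
  rw [extendForm, dif_pos h, hA h.choose j x h.choose_spec hx,
    gauge_diff_gauge_diff hρ (hσ _ x h.choose_spec) (hσ j x hx)]

theorem extendForm_glue
    (hσ : ∀ j, ∀ x ∈ U j, SmoothObj (σ j) x)
    (hA : ∀ i j x, x ∈ U i → x ∈ U j → A i x = gauge (fun y => (σ i y).diff (σ j y)) (A j x))
    {ρ ρ' : ∀ x, TelBundleObj T x} (hρ : SmoothObj ρ x)
    (hρ' : SmoothObj ρ' x) {j : J} (hx : x ∈ U j) :
    extendForm U σ A ρ x = gauge (fun y => (ρ y).diff (ρ' y)) (extendForm U σ A ρ' x) := by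
  rw [extendForm_eq hσ hA hρ hx, extendForm_eq hσ hA hρ' hx,
    gauge_diff_gauge_diff hρ hρ' (hσ j x hx)]

theorem extendForm_smooth [FiniteDimensional ℝ E]
    (hσ : ∀ j, ∀ x ∈ U j, SmoothObj (σ j) x)
    (hA : ∀ i j x, x ∈ U i → x ∈ U j → A i x = gauge (fun y => (σ i y).diff (σ j y)) (A j x))
    {ρ : ∀ x, TelBundleObj T x}
    (hρ : ∀ᶠ y in 𝓝 x, SmoothObj ρ y) {j : J} (hx : x ∈ U j) (hj : SmoothForm1At (A j) x) :
    SmoothForm1At (extendForm U σ A ρ) x := by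
  refine (hj.gauge (hρ.self_of_nhds.smoothIO_diff (hσ j x hx))).congr ?_
  filter_upwards [hρ, (U j).isOpen.mem_nhds hx] with y hy hy'
  exact extendForm_eq hσ hA hy hy'

end Extension

/-- The composite of a bilinear map and a linear map. -/
def postcomp₂ {U W W' : Type*} [AddCommGroup U] [Module ℝ U] [TopologicalSpace U]
    [AddCommGroup W] [Module ℝ W] [TopologicalSpace W] [IsTopologicalAddGroup W]
    [ContinuousSMul ℝ W] [AddCommGroup W'] [Module ℝ W'] [TopologicalSpace W']
    [IsTopologicalAddGroup W'] [ContinuousSMul ℝ W'] (L : W →L[ℝ] W') (b : U →L[ℝ] U →L[ℝ] W) :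
    U →L[ℝ] U →L[ℝ] W' :=
  (ContinuousLinearMap.postcomp U L).comp b

theorem postcomp₂_apply {U W W' : Type*} [AddCommGroup U] [Module ℝ U] [TopologicalSpace U]
    [AddCommGroup W] [Module ℝ W] [TopologicalSpace W] [IsTopologicalAddGroup W]
    [ContinuousSMul ℝ W] [AddCommGroup W'] [Module ℝ W'] [TopologicalSpace W']
    [IsTopologicalAddGroup W'] [ContinuousSMul ℝ W'] (L : W →L[ℝ] W') (b : U →L[ℝ] U →L[ℝ] W)
    (v w : U) : postcomp₂ L b v w = L (b v w) := rfl

/-! ## The connection `θ + e` and the torsion -/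

section Torsion

variable {p q : ℕ}
  {E : Type*} [NormedAddCommGroup E] [NormedSpace ℝ E] [FiniteDimensional ℝ E]
  {M : Type*} [TopologicalSpace M] [ChartedSpace E M] [IsManifold 𝓘(ℝ, E) ∞ M]
  {F : Type*} [NormedAddCommGroup F] [NormedSpace ℝ F] [FiniteDimensional ℝ F]
  {V : M → Type*} [TopologicalSpace (TotalSpace F V)]
  [∀ x, AddCommGroup (V x)] [∀ x, Module ℝ (V x)] [∀ x, TopologicalSpace (V x)]
  [∀ x, IsTopologicalAddGroup (V x)] [∀ x, ContinuousSMul ℝ (V x)]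
  [FiberBundle F V] [VectorBundle ℝ F V] [ContMDiffVectorBundle ∞ F V 𝓘(ℝ, E)]
  {T : FakeTangentBundle (E := E) p q F V} {x : M}

/-- The gauge transform of `ξ + u` under an `O(p,q)`-valued function. -/
theorem gauge_ofO {k : M → Opq p q}
    (hk : ContMDiffAt 𝓘(ℝ, E) 𝓘(ℝ, EndR p q) ∞ (fun y => (k y).toEnd) x)
    {A : TangentSpace 𝓘(ℝ, E) x →L[ℝ] Aff p q} {v : TangentSpace 𝓘(ℝ, E) x} {ξ : EndR p q}
    {u : Rpq p q} (hA : A v = ioMk ξ u) :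
    gauge (fun y => IOpq.ofO p q (k y)) A v =
      ioMk ((k x).toEnd * ξ * (k x)⁻¹.toEnd + (k x).toEnd * dFun (fun y => (k y)⁻¹.toEnd) x v)
        ((k x).toEnd u) := by
  -- No translation part means no inhomogeneous term in the `ℝ^{p,q}`-component.
  have h0 : (fun y => (IOpq.ofO p q (k y))⁻¹.trans) = fun _ : M => (0 : Rpq p q) :=
    funext fun y => by
      rw [IOpq.inv_trans]
      exact neg_eq_zero.2 (map_zero _)
  have h1 : dFun (E := E) (fun y => (IOpq.ofO p q (k y))⁻¹.trans) x v = 0 := by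
    rw [h0, dFun_const]
    rfl
  rw [gauge_eq, hA, dFun_mat (smoothIO_ofO hk).inv, IOpq.conj_ioMk, IOpq.mat_mul_ioMk, ioMk_add, h1]
  have h2 : (IOpq.ofO p q (k x)).trans = 0 := rfl
  rw [h2, map_zero, map_zero, sub_zero, map_zero, add_zero]
  rfl

/-- The `ℝ^{p,q}`-valued form `s⁻¹ ∘ e`. -/
def Form1.coform (e : Form1 T) (s : LocalFrame T) (x : M) :
    TangentSpace 𝓘(ℝ, E) x →L[ℝ] Rpq p q :=
  ((s.s x).toEquiv.symm : V x →L[ℝ] Rpq p q).comp (e.val x)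

theorem Form1.coform_apply (e : Form1 T) (s : LocalFrame T) (v : TangentSpace 𝓘(ℝ, E) x) :
    e.coform s x v = (s.s x).toEquiv.symm (e.val x v) := rfl

theorem Form1.smooth_coform (e : Form1 T) (s : LocalFrame T) (hx : x ∈ s.U) :
    SmoothForm1At (e.coform s) x :=
  smoothForm1At_iff.2 fun X hX => (s.contMDiffAt_section_iff hx).1
    (contMDiffAt_form1_iff.1 (e.smooth x) X hX)

/-- The local form of the connection `θ + e` on the bundle of objects. -/
def Connection.full (θ : Connection T) (e : Form1 T) (s : LocalFrame T) (x : M) :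
    TangentSpace 𝓘(ℝ, E) x →L[ℝ] Aff p q :=
  (ioL p q).comp ((θ.form s x).prod (e.coform s x))

variable (θ : Connection T) (e : Form1 T) (s : LocalFrame T)

theorem Connection.full_apply (v : TangentSpace 𝓘(ℝ, E) x) :
    θ.full e s x v = ioMk (θ.form s x v) (e.coform s x v) := rfl

theorem Connection.full_mem (v : TangentSpace 𝓘(ℝ, E) x) : θ.full e s x v ∈ io p q :=
  ioMk_mem (θ.mem s x v) _

theorem Connection.smooth_form (hx : x ∈ s.U) : SmoothForm1At (θ.form s) x :=
  smoothForm1_iff.1 (θ.smooth s) x hx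

theorem Connection.smooth_pair (hx : x ∈ s.U) :
    SmoothForm1At (fun y => (θ.form s y).prod (e.coform s y)) x :=
  smoothForm1At_iff.2 fun X hX =>
    (smoothForm1At_iff.1 (θ.smooth_form s hx) X hX).prodMk_space
      (smoothForm1At_iff.1 (e.smooth_coform s hx) X hX)

theorem Connection.smooth_full (hx : x ∈ s.U) : SmoothForm1At (θ.full e s) x :=
  smoothForm1At_iff.2 fun X hX => contMDiffAt_clm (ioL p q)
    (smoothForm1At_iff.1 (θ.smooth_pair e s hx) X hX)

theorem LocalFrame.change_eq (s s' : LocalFrame T) (y : M) :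
    (s'.s y).change (s.s y) = ((s.s y).diff (s'.s y))⁻¹.toEnd := by
  rw [Frame.inv_diff]
  rfl

/-- The rotation part is the gluing law of `θ`; the translation part says that `s⁻¹ e` and `s'⁻¹ e`
describe the same vector. -/
theorem Connection.full_glue (s s' : LocalFrame T) (hx : x ∈ s.U) (hx' : x ∈ s'.U) :
    θ.full e s x = gauge (fun y => (s.obj y).diff (s'.obj y)) (θ.full e s' x) := by
  refine ContinuousLinearMap.ext fun v => ?_
  simp_rw [LocalFrame.diff_obj]
  refine Eq.trans ?_ (gauge_ofO (s.contMDiffAt_change s' hx hx') (θ.full_apply e s' v)).symm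
  rw [θ.full_apply, θ.glue s s' x ⟨hx, hx'⟩, gaugeTransform, ioMk_inj]
  refine ⟨?_, ?_⟩
  · simp_rw [LocalFrame.change_eq s s']
    rfl
  · rw [Form1.coform_apply, Form1.coform_apply]
    change _ = (s.s x).toEquiv.symm ((s'.s x).toEquiv _)
    rw [ContinuousLinearEquiv.apply_symm_apply]

/-- The components of the torsion `d_θ e` in the local frame `s`. -/
def Connection.tors (x : M) :
    TangentSpace 𝓘(ℝ, E) x →L[ℝ] TangentSpace 𝓘(ℝ, E) x →L[ℝ] Rpq p q :=
  let c : E →L[ℝ] Rpq p q := e.coform s x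
  let f : E →L[ℝ] EndR p q := θ.form s x
  let d : E →L[ℝ] E →L[ℝ] Rpq p q := dFormL (e.coform s) x
  let r : E →L[ℝ] E →L[ℝ] Rpq p q :=
    ((ContinuousLinearMap.compL ℝ E (Rpq p q) (Rpq p q)).flip c).comp f
  (d + r - r.flip : E →L[ℝ] E →L[ℝ] Rpq p q)

theorem Connection.tors_apply (hx : x ∈ s.U) (v w : TangentSpace 𝓘(ℝ, E) x) :
    θ.tors e s x v w = dForm (e.coform s) x v w + θ.form s x v (e.coform s x w)
      - θ.form s x w (e.coform s x v) := by
  rw [← dFormL_apply (e.smooth_coform s hx)]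
  rfl

/-- The exterior derivative acts componentwise, and the mixed terms of the bracket of `𝔦𝔬(p,q)`
supply exactly `θ ∧ e`. Thus the translation part of the curvature is the torsion. -/
theorem Connection.curvature_full (hx : x ∈ s.U) (v w : TangentSpace 𝓘(ℝ, E) x) :
    curvature (θ.full e s) x v w = ioMk (curvature (θ.form s) x v w) (θ.tors e s x v w) := by
  have h := θ.smooth_pair e s hx
  have h1 := dForm_clm_comp (ContinuousLinearMap.fst ℝ (EndR p q) (Rpq p q)) h
    (θ.smooth_form s hx) v w
  have h2 := dForm_clm_comp (ContinuousLinearMap.snd ℝ (EndR p q) (Rpq p q)) h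
    (e.smooth_coform s hx) v w
  have h3 := dForm_clm_comp (ioL p q) h (θ.smooth_full e s hx) v w
  change dForm (θ.form s) x v w = _ at h1
  change dForm (e.coform s) x v w = _ at h2
  change dForm (θ.full e s) x v w = _ at h3
  rw [curvature, θ.full_apply, θ.full_apply, ioMk_bracket, h3, ioL_apply, ioMk_add,
    θ.tors_apply e s hx, curvature, h1, h2, add_sub_assoc]
  rfl

-- The invariant formula for `d` matches both sides on vector fields, and every tangent vector is
-- the value of a smooth field. The condition on fields is therefore a pointwise one.
variable {θ e} in
theorem isTorsion_iff {τ : Form2 T} :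
    IsTorsion θ e τ ↔ ∀ (s : LocalFrame T), ∀ x ∈ s.U, ∀ v w,
      τ.val x v w = (s.s x).toEquiv (θ.tors e s x v w) := by
  have : CompleteSpace E := FiniteDimensional.complete ℝ E
  have key : ∀ (s : LocalFrame T), ∀ x ∈ s.U, ∀ X Y : ∀ y : M, TangentSpace 𝓘(ℝ, E) y,
      SmoothField X x → SmoothField Y x →
      (s.s x).toEquiv (θ.tors e s x (X x) (Y x)) =
        θ.covDeriv s (fun y => e.val y (Y y)) x (X x)
        - θ.covDeriv s (fun y => e.val y (X y)) x (Y x)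
        - e.val x (VectorField.mlieBracket 𝓘(ℝ, E) X Y x) := by
    intro s x hx X Y hX hY
    have h := dForm_apply_fields (e.smooth_coform s hx) hX hY
    rw [θ.tors_apply e s hx, h, Connection.covDeriv, Connection.covDeriv, ← map_sub]
    have h' : e.val x (VectorField.mlieBracket 𝓘(ℝ, E) X Y x) =
        (s.s x).toEquiv (e.coform s x (VectorField.mlieBracket 𝓘(ℝ, E) X Y x)) := by
      rw [Form1.coform_apply, ContinuousLinearEquiv.apply_symm_apply]
    rw [h', ← map_sub]
    simp only [Form1.coform_apply]
    congr 1
    abel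
  constructor
  · intro h s x hx v w
    obtain ⟨X, hX, rfl⟩ := exists_smoothField x v
    obtain ⟨Y, hY, rfl⟩ := exists_smoothField x w
    rw [key s x hx X Y hX hY]
    exact h s x hx X Y hX hY
  · intro h s x hx X Y hX hY
    rw [h s x hx, key s x hx X Y hX hY]

/-- The exterior derivative at `y` is defined through the chart around `y`, which varies with `y`,
so its smoothness is not visible from the definition. The formula in terms of `X`, `Y` and their
bracket replaces it by manifestly smooth terms, provided that the fields are smooth at all nearby
points. -/
theorem Connection.tors_smooth (hx : x ∈ s.U) {X Y : ∀ y : M, TangentSpace 𝓘(ℝ, E) y}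
    (hX : SmoothField X x) (hY : SmoothField Y x) (hX' : ∀ᶠ y in 𝓝 x, SmoothField X y)
    (hY' : ∀ᶠ y in 𝓝 x, SmoothField Y y) :
    ContMDiffAt 𝓘(ℝ, E) 𝓘(ℝ, Rpq p q) ∞ (fun y => θ.tors e s y (X y) (Y y)) x := by
  have : CompleteSpace E := FiniteDimensional.complete ℝ E
  have hf := smoothForm1At_iff.1 (θ.smooth_form s hx)
  have he := smoothForm1At_iff.1 (e.smooth_coform s hx)
  have h : ContMDiffAt 𝓘(ℝ, E) 𝓘(ℝ, Rpq p q) ∞ (fun y =>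
      dFun (fun z => e.coform s z (Y z)) y (X y) - dFun (fun z => e.coform s z (X z)) y (Y y)
        - e.coform s y (VectorField.mlieBracket 𝓘(ℝ, E) X Y y)
        + θ.form s y (X y) (e.coform s y (Y y)) - θ.form s y (Y y) (e.coform s y (X y))) x :=
    (((((contMDiffAt_dFun_apply (he Y hY) hX).sub (contMDiffAt_dFun_apply (he X hX) hY)).sub
      (he _ (hX.mlieBracket hY))).add ((hf X hX).clm_apply (he Y hY))).sub
      ((hf Y hY).clm_apply (he X hX)))
  refine h.congr_of_eventuallyEq ?_
  filter_upwards [hX', hY', s.U.isOpen.mem_nhds hx] with y hy hy' hys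
  rw [θ.tors_apply e s hys, dForm_apply_fields (e.smooth_coform s hys) hy hy']

theorem Connection.tors_self (hx : x ∈ s.U) (v : TangentSpace 𝓘(ℝ, E) x) :
    θ.tors e s x v v = 0 := by
  rw [θ.tors_apply e s hx, dForm_eq (e.smooth_coform s hx), sub_self, zero_add, sub_self]

/-- The components of the torsion in different frames describe the same vector. -/
theorem Connection.toEquiv_tors (s s' : LocalFrame T) (hx : x ∈ s.U) (hx' : x ∈ s'.U)
    (v w : TangentSpace 𝓘(ℝ, E) x) :
    (s.s x).toEquiv (θ.tors e s x v w) = (s'.s x).toEquiv (θ.tors e s' x v w) := by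
  have h := curvature_gauge (θ.smooth_full e s hx) (θ.smooth_full e s' hx')
    (s.smoothIO_diff s' hx hx') (by
      filter_upwards [s.U.isOpen.mem_nhds hx, s'.U.isOpen.mem_nhds hx'] with y hy hy'
      exact θ.full_glue e s s' hy hy') v w
  rw [θ.curvature_full e s hx, θ.curvature_full e s' hx', IOpq.conj_ioMk, LocalFrame.diff_obj] at h
  -- Only the translation part of the conjugated curvature matters; the transition has no
  -- translation, so the curvature of `θ` does not enter and `θ` need not be flat.
  rw [(ioMk_inj.1 h).2]
  have h2 : (IOpq.ofO p q ((s.s x).diff (s'.s x))).trans = 0 := rfl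
  rw [h2, map_zero, map_zero, sub_zero]
  exact (s.s x).toEquiv.apply_symm_apply _

/-- It suffices to test on fields that are constant in a trivialization, and these are smooth on a
whole neighbourhood, as `Connection.tors_smooth` requires. -/
theorem smoothAt_torsion
    {τ : ∀ x : M, TangentSpace 𝓘(ℝ, E) x →L[ℝ] TangentSpace 𝓘(ℝ, E) x →L[ℝ] V x}
    (hx : x ∈ s.U) (h : ∀ y ∈ s.U, ∀ v w, τ y v w = (s.s y).toEquiv (θ.tors e s y v w)) :
    ContMDiffAt 𝓘(ℝ, E) (𝓘(ℝ, E).prod 𝓘(ℝ, E →L[ℝ] E →L[ℝ] F)) ∞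
      (fun y => (TotalSpace.mk' (E →L[ℝ] E →L[ℝ] F) y (τ y) :
        TotalSpace (E →L[ℝ] E →L[ℝ] F) fun y : M =>
          TangentSpace 𝓘(ℝ, E) y →L[ℝ] TangentSpace 𝓘(ℝ, E) y →L[ℝ] V y)) x := by
  refine contMDiffAt_hom_of_apply fun v => contMDiffAt_hom_of_apply fun w =>
    (s.contMDiffAt_section_iff hx).2 ?_
  refine (θ.tors_smooth e s hx (smoothField_constField (E := E) x v)
    (smoothField_constField (E := E) x w) (eventually_smoothField_constField x v)
    (eventually_smoothField_constField x w)).congr_of_eventuallyEq ?_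
  filter_upwards [s.U.isOpen.mem_nhds hx] with y hy
  refine (s.s y).toEquiv.injective ((ContinuousLinearEquiv.apply_symm_apply _ _).trans ?_)
  exact h y hy _ _

theorem existsUnique_torsion (hs : ∀ x : M, ∃ s : LocalFrame T, x ∈ s.U) :
    ∃! τ : Form2 T, IsTorsion θ e τ := by
  choose s hs using hs
  -- Any choice of frame at each point will do: `Connection.toEquiv_tors` gives the same vector in
  -- all frames, and near `x` the single frame `s x` may be used to check smoothness.
  let τ : Form2 T :=
    { val := fun x => postcomp₂ (((s x).s x).toEquiv : Rpq p q →L[ℝ] V x) (θ.tors e (s x) x)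
      alt := fun x v => by
        rw [postcomp₂_apply, θ.tors_self e (s x) (hs x), map_zero]
      smooth := fun x => smoothAt_torsion θ e (s x) (hs x)
        fun y hy v w => θ.toEquiv_tors e (s y) (s x) (hs y) hy v w }
  refine ⟨τ, isTorsion_iff.2 fun s' x hx v w => θ.toEquiv_tors e (s x) s' (hs x) hx v w,
    fun τ' h => ?_⟩
  refine Form2.ext (funext fun x => ?_)
  refine ContinuousLinearMap.ext fun v => ContinuousLinearMap.ext fun w => ?_
  exact isTorsion_iff.1 h (s x) x (hs x) v w

end Torsion

/-! ## 2-connections -/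

section TwoConnections

variable {p q : ℕ}
  {E : Type*} [NormedAddCommGroup E] [NormedSpace ℝ E] [FiniteDimensional ℝ E]
  {M : Type*} [TopologicalSpace M] [ChartedSpace E M] [IsManifold 𝓘(ℝ, E) ∞ M]
  {F : Type*} [NormedAddCommGroup F] [NormedSpace ℝ F] [FiniteDimensional ℝ F]
  {V : M → Type*} [TopologicalSpace (TotalSpace F V)]
  [∀ x, AddCommGroup (V x)] [∀ x, Module ℝ (V x)] [∀ x, TopologicalSpace (V x)]
  [∀ x, IsTopologicalAddGroup (V x)] [∀ x, ContinuousSMul ℝ (V x)]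
  [FiberBundle F V] [VectorBundle ℝ F V] [ContMDiffVectorBundle ∞ F V 𝓘(ℝ, E)]
  {T : FakeTangentBundle (E := E) p q F V} {x : M}
  {ι : Type*} {t : ι → LocalTriv T}

theorem gauge_inv_apply (a : M → IOpq p q) (A : TangentSpace 𝓘(ℝ, E) x →L[ℝ] Aff p q)
    (v : TangentSpace 𝓘(ℝ, E) x) :
    gauge (fun y => (a y)⁻¹) A v =
      (a x)⁻¹.mat * A v * (a x).mat + (a x)⁻¹.mat * dFun (fun y => (a y).mat) x v := by
  simp_rw [gauge_eq, inv_inv]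

/-- On the common domain, a frame `s` admits only one `a` with unit section `[s, a]`, namely the
torsor difference. The quantifier over `a` thus disappears. -/
theorem TwoConnection.hasOneFormPart_iff {C : TwoConnection t} {θ : Connection T} {e : Form1 T} :
    C.HasOneFormPart θ e ↔ ∀ (i : ι) (s : LocalFrame T), ∀ x ∈ (t i).U, x ∈ s.U →
      C.A i x = gauge (fun y => ((t i).unitObj y).diff (s.obj y)) (θ.full e s x) := by
  constructor
  · intro h i s x hx hs
    refine ContinuousLinearMap.ext fun v => ?_
    have h' := h i s (fun y => (s.obj y).diff ((t i).unitObj y)) (fun y _ => by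
      have h1 := TelBundleObj.act_diff (s.obj y) ((t i).unitObj y)
      rw [LocalFrame.obj, TelBundleObj.mk_act, one_mul] at h1
      exact h1.symm) x ⟨hx, hs⟩ v
    rw [h']
    refine (gauge_inv_apply (fun y => (s.obj y).diff ((t i).unitObj y)) (θ.full e s x) v).symm.trans
      ?_
    simp_rw [TelBundleObj.inv_diff]
  · intro h i s a ha x hx v
    rw [h i s x hx.1 hx.2]
    refine Eq.trans ?_ (gauge_inv_apply a (θ.full e s x) v)
    refine DFunLike.congr_fun (gauge_congr ?_) v
    filter_upwards [(t i).U.isOpen.mem_nhds hx.1, s.U.isOpen.mem_nhds hx.2] with y hy hy'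
    have h1 : (t i).unitObj y = TelBundleObj.mk (s.s y) (a y) := ha y ⟨hy, hy'⟩
    rw [h1, ← TelBundleObj.inv_diff, LocalFrame.diff_mk]

/-- The action `α` sees only the rotation part of `a`, and `lin` is the frame already rotated by it,
so the representative `[f, a]` drops out. -/
theorem TwoConnection.hasTwoFormPart_iff {C : TwoConnection t} {τ : Form2 T} :
    C.HasTwoFormPart τ ↔ ∀ i, ∀ x ∈ (t i).U, ∀ v w,
      τ.val x v w = ((t i).unitObj x).lin (C.B i x v w) := by
  constructor
  · intro h i x hx v w
    obtain ⟨f, a, ha⟩ := TelBundleObj.exists_frame ((t i).unitObj x)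
    rw [h i x hx f a ha, ha, TelBundleObj.lin_mk, crossedα_eq]
  · intro h i x hx f a ha v w
    have ha' : (t i).unitObj x = TelBundleObj.mk f a := ha
    rw [h i x hx, ha', TelBundleObj.lin_mk, crossedα_eq]

theorem TwoConnection.A_eq (C : TwoConnection t) (i j : ι) (x : M) (hi : x ∈ (t i).U)
    (hj : x ∈ (t j).U) :
    C.A i x = gauge (fun y => ((t i).unitObj y).diff ((t j).unitObj y)) (C.A j x) := by
  refine ContinuousLinearMap.ext fun v => ?_
  rw [C.glue_A i j x ⟨hi, hj⟩]
  refine (gauge_apply _ _ _).symm.trans (DFunLike.congr_fun (gauge_congr ?_) v)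
  filter_upwards [(t i).U.isOpen.mem_nhds hi] with y hy
  exact (t i).transition_eq (t j) hy

theorem TwoConnection.lin_B_eq (C : TwoConnection t) (i j : ι) (x : M) (hi : x ∈ (t i).U)
    (hj : x ∈ (t j).U) (v w : TangentSpace 𝓘(ℝ, E) x) :
    ((t i).unitObj x).lin (C.B i x v w) = ((t j).unitObj x).lin (C.B j x v w) := by
  rw [C.glue_B i j x ⟨hi, hj⟩, crossedα_eq, (t i).transition_eq (t j) hi, TelBundleObj.lin_diff]

/-- A local form of the connection `θ + e` has curvature `(0, b)` if and only if the curvature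
of `θ` vanishes and the torsion is described by `b`. -/
theorem curvature_eq_infT_iff {θ : Connection T} {e : Form1 T} {s : LocalFrame T} (hx : x ∈ s.U)
    {σ : ∀ x, TelBundleObj T x} (hσ : SmoothObj σ x)
    {A : ∀ x : M, TangentSpace 𝓘(ℝ, E) x →L[ℝ] Aff p q} (hA : SmoothForm1At A x)
    (h : ∀ᶠ y in 𝓝 x, A y = gauge (fun y => (σ y).diff (s.obj y)) (θ.full e s y))
    (v w : TangentSpace 𝓘(ℝ, E) x) (b : Rpq p q) :
    curvature A x v w = infT b ↔
      curvature (θ.form s) x v w = 0 ∧ (s.s x).toEquiv (θ.tors e s x v w) = (σ x).lin b := by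
  rw [curvature_gauge hA (θ.smooth_full e s hx) (hσ.smoothIO_diff (s.smoothObj hx)) h,
    θ.curvature_full e s hx, IOpq.conj_ioMk, infT, ioMk_inj, ← LocalFrame.lin_obj,
    ← TelBundleObj.lin_diff (σ x), (σ x).lin.injective.eq_iff]
  set k := ((σ x).diff (s.obj x)).rot
  have h0 : k.toEnd * curvature (θ.form s) x v w * k⁻¹.toEnd = 0 ↔
      curvature (θ.form s) x v w = 0 := by
    refine ⟨fun hk => ContinuousLinearMap.ext fun u => ?_, fun hk => by rw [hk]; simp⟩
    have h1 : k.toEnd (curvature (θ.form s) x v w (k⁻¹.toEnd (k.toEnd u))) = 0 :=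
      DFunLike.congr_fun hk (k.toEnd u)
    rw [Opq.toEnd_inv_apply] at h1
    rw [← Opq.toEnd_inv_apply k (curvature (θ.form s) x v w u), h1, map_zero]
    rfl
  rw [h0]
  -- The translation part of the conjugate contains a curvature term; it vanishes by the first
  -- condition, which is why the two conditions are compared jointly.
  refine and_congr_right fun h1 => ?_
  rw [h1]
  change k.toEnd (_ - 0) = _ ↔ _
  rw [sub_zero]

/-- Near a point of `U i` the form `A i` is a gauge transform of `θ + e`, so fake flatness is the
left-hand side of `curvature_eq_infT_iff`, with `b` the value of `B i`. -/
theorem TwoConnection.flat_and_isTorsion (ht : ∀ x, ∃ i, x ∈ (t i).U) {C : TwoConnection t}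
    {θ : Connection T} {e : Form1 T} {τ : Form2 T} (h₁ : C.HasOneFormPart θ e)
    (h₂ : C.HasTwoFormPart τ) : θ.IsFlat ∧ IsTorsion θ e τ := by
  rw [TwoConnection.hasOneFormPart_iff] at h₁
  rw [TwoConnection.hasTwoFormPart_iff] at h₂
  have key : ∀ (s : LocalFrame T), ∀ x ∈ s.U, ∀ v w, curvature (θ.form s) x v w = 0 ∧
      (s.s x).toEquiv (θ.tors e s x v w) = τ.val x v w := by
    intro s x hx v w
    obtain ⟨i, hi⟩ := ht x
    rw [h₂ i x hi]
    refine (curvature_eq_infT_iff hx ((t i).smoothObj hi) (smoothForm1_iff.1 (C.A_smooth i) x hi)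
      ?_ v w (C.B i x v w)).1 (C.fake_flat i x hi v w)
    filter_upwards [(t i).U.isOpen.mem_nhds hi, s.U.isOpen.mem_nhds hx] with y hy hy'
    exact h₁ i s y hy hy'
  exact ⟨fun s x hx v w => (key s x hx v w).1,
    isTorsion_iff.2 fun s x hx v w => (key s x hx v w).2.symm⟩

theorem LocalFrame.exists_mem (ht : ∀ x, ∃ i, x ∈ (t i).U) (x : M) :
    ∃ s : LocalFrame T, x ∈ s.U :=
  (ht x).elim fun i hi => (t i).exists_localFrame hi

/-! ### The 2-connection of a flat connection and a 1-form -/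

section OfTorsion

variable (t) (θ : Connection T) (e : Form1 T) (τ : Form2 T)

open Classical in
/-- The 1-forms of the 2-connection determined by `θ` and `e`. -/
def telA (i : ι) (x : M) : TangentSpace 𝓘(ℝ, E) x →L[ℝ] Aff p q :=
  if x ∈ (t i).U then
    extendForm (fun s : LocalFrame T => s.U) LocalFrame.obj (θ.full e) (t i).unitObj x else 0

open Classical in
/-- The 2-forms of the 2-connection with 2-form part `τ`. -/
def telB (i : ι) (x : M) :
    TangentSpace 𝓘(ℝ, E) x →L[ℝ] TangentSpace 𝓘(ℝ, E) x →L[ℝ] Rpq p q :=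
  if x ∈ (t i).U then
    postcomp₂ (((t i).unitObj x).lin.symm : V x →L[ℝ] Rpq p q) (τ.val x) else 0

variable {t}

theorem telA_eq_extendForm {i : ι} (hx : x ∈ (t i).U) : telA t θ e i x =
    extendForm (fun s : LocalFrame T => s.U) LocalFrame.obj (θ.full e) (t i).unitObj x :=
  if_pos hx

theorem telA_eq {i : ι} (hx : x ∈ (t i).U) {s : LocalFrame T} (hs : x ∈ s.U) : telA t θ e i x =
    gauge (fun y => ((t i).unitObj y).diff (s.obj y)) (θ.full e s x) := by
  rw [telA_eq_extendForm θ e hx]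
  exact extendForm_eq (fun s x hx => s.smoothObj hx)
    (fun s s' x hx hx' => θ.full_glue e s s' hx hx') ((t i).smoothObj hx) hs

theorem smooth_telA (hs : ∀ x : M, ∃ s : LocalFrame T, x ∈ s.U) {i : ι} (hx : x ∈ (t i).U) :
    SmoothForm1At (telA t θ e i) x := by
  obtain ⟨s, hs⟩ := hs x
  have hn := (t i).U.isOpen.mem_nhds hx
  refine (extendForm_smooth (U := fun s : LocalFrame T => s.U) (fun s x hx => s.smoothObj hx)
    (fun s s' x hx hx' => θ.full_glue e s s' hx hx')
    (Filter.mem_of_superset hn fun y hy => (t i).smoothObj hy) hs (θ.smooth_full e s hs)).congr ?_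
  filter_upwards [hn] with y hy
  exact telA_eq_extendForm θ e hy

theorem telB_apply {i : ι} (hx : x ∈ (t i).U) (v w : TangentSpace 𝓘(ℝ, E) x) :
    telB t τ i x v w = ((t i).unitObj x).lin.symm (τ.val x v w) := by
  rw [telB, if_pos hx]
  rfl

theorem lin_telB {i : ι} (hx : x ∈ (t i).U) (v w : TangentSpace 𝓘(ℝ, E) x) :
    ((t i).unitObj x).lin (telB t τ i x v w) = τ.val x v w := by
  rw [telB_apply τ hx, ContinuousLinearEquiv.apply_symm_apply]

variable {θ e τ}

/-- The 2-connection with 1-form part `θ + e` and 2-form part `τ = d_θ e`. -/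
def TwoConnection.ofTorsion (ht : ∀ x, ∃ i, x ∈ (t i).U) (hθ : θ.IsFlat) (hτ : IsTorsion θ e τ) :
    TwoConnection t where
  A := telA t θ e
  B := telB t τ
  A_mem i x v := by
    by_cases hx : x ∈ (t i).U
    · obtain ⟨s, hs⟩ := LocalFrame.exists_mem ht x
      rw [telA_eq θ e hx hs]
      exact gauge_mem_io (((t i).smoothObj hx).smoothIO_diff (s.smoothObj hs)) (θ.full_mem e s v)
    · rw [telA, if_neg hx]
      exact zero_mem_io
  A_smooth i := smoothForm1_iff.2 fun x hx => smooth_telA θ e (LocalFrame.exists_mem ht) hx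
  A_zero i x hx := if_neg hx
  B_alt i x v := by
    by_cases hx : x ∈ (t i).U
    · rw [telB_apply τ hx, τ.alt, map_zero]
    · rw [telB, if_neg hx]
      rfl
  B_smooth i := smoothForm2_iff.2 fun x hx X Y hX hY => by
    have h := (((t i).smoothObj hx).contMDiffAt_section_iff (u := fun y => τ.val y (X y) (Y y))).1
      (contMDiffAt_form2_iff.1 (τ.smooth x) X Y hX hY)
    refine h.congr_of_eventuallyEq ?_
    filter_upwards [(t i).U.isOpen.mem_nhds hx] with y hy
    exact telB_apply τ hy _ _
  B_zero i x hx := if_neg hx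
  fake_flat i x hx v w := by
    obtain ⟨s, hs⟩ := LocalFrame.exists_mem ht x
    -- The same equivalence as for the direct statement, now read backwards from flatness and the
    -- torsion identity.
    refine (curvature_eq_infT_iff (e := e) hs ((t i).smoothObj hx)
      (smooth_telA θ e (LocalFrame.exists_mem ht) hx) ?_ v w _).2 ⟨hθ s x hs v w, ?_⟩
    · filter_upwards [(t i).U.isOpen.mem_nhds hx, s.U.isOpen.mem_nhds hs] with y hy hy'
      exact telA_eq θ e hy hy'
    · rw [lin_telB τ hx, isTorsion_iff.1 hτ s x hs]
  glue_A i j x hx v := by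
    obtain ⟨s, hs⟩ := LocalFrame.exists_mem ht x
    have hi := (t i).smoothObj hx.1
    have hj := (t j).smoothObj hx.2
    refine Eq.trans ?_ (gauge_apply _ _ _)
    rw [telA_eq θ e hx.1 hs, telA_eq θ e hx.2 hs,
      ← gauge_diff_gauge_diff hi hj (s.smoothObj hs)]
    refine DFunLike.congr_fun (gauge_congr ?_) v
    filter_upwards [(t i).U.isOpen.mem_nhds hx.1] with y hy
    exact ((t i).transition_eq (t j) hy).symm
  glue_B i j x hx v w := by
    rw [crossedα_eq, (t i).transition_eq (t j) hx.1]
    refine ((t i).unitObj x).lin.injective ?_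
    rw [TelBundleObj.lin_diff, lin_telB τ hx.1, lin_telB τ hx.2]

theorem TwoConnection.existsUnique_of_isTorsion (ht : ∀ x, ∃ i, x ∈ (t i).U) (hθ : θ.IsFlat)
    (hτ : IsTorsion θ e τ) :
    ∃! C : TwoConnection t, C.HasOneFormPart θ e ∧ C.HasTwoFormPart τ := by
  refine ⟨.ofTorsion ht hθ hτ, ⟨TwoConnection.hasOneFormPart_iff.2 fun i s x hx hs =>
      telA_eq θ e hx hs, TwoConnection.hasTwoFormPart_iff.2 fun i x hx v w =>
      (lin_telB τ hx v w).symm⟩, fun C hC => ?_⟩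
  have h₁ := TwoConnection.hasOneFormPart_iff.1 hC.1
  have h₂ := TwoConnection.hasTwoFormPart_iff.1 hC.2
  -- On `U i` the two parts determine the forms; off `U i` both are zero by convention, and without
  -- it uniqueness would fail.
  refine TwoConnection.ext (funext fun i => funext fun x => ?_) (funext fun i => funext fun x => ?_)
  · change C.A i x = telA t θ e i x
    by_cases hx : x ∈ (t i).U
    · obtain ⟨s, hs⟩ := LocalFrame.exists_mem ht x
      rw [h₁ i s x hx hs, telA_eq θ e hx hs]
    · rw [C.A_zero i x hx, telA, if_neg hx]
  · change C.B i x = telB t τ i x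
    by_cases hx : x ∈ (t i).U
    · refine ContinuousLinearMap.ext fun v => ContinuousLinearMap.ext fun w => ?_
      refine ((t i).unitObj x).lin.injective ?_
      rw [← h₂ i x hx, lin_telB τ hx]
    · rw [C.B_zero i x hx, telB, if_neg hx]

end OfTorsion

/-! ### The decomposition of a 2-connection -/

section Decomposition

variable (C : TwoConnection t)

/-- The local form, in a local frame, of the connection on the bundle of objects described by
the 1-forms of a 2-connection. -/
def TwoConnection.localForm (s : LocalFrame T) (x : M) : TangentSpace 𝓘(ℝ, E) x →L[ℝ] Aff p q :=
  extendForm (fun i => (t i).U) (fun i => (t i).unitObj) C.A s.obj x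

variable {s s' : LocalFrame T}

theorem TwoConnection.localForm_eq (hs : x ∈ s.U) {i : ι} (hx : x ∈ (t i).U) :
    C.localForm s x = gauge (fun y => (s.obj y).diff ((t i).unitObj y)) (C.A i x) :=
  extendForm_eq (U := fun i => (t i).U) (fun i _ hx => (t i).smoothObj hx) C.A_eq
    (s.smoothObj hs) hx

theorem TwoConnection.localForm_mem (hs : x ∈ s.U) {i : ι} (hx : x ∈ (t i).U)
    (v : TangentSpace 𝓘(ℝ, E) x) : C.localForm s x v ∈ io p q := by
  rw [C.localForm_eq hs hx]
  exact gauge_mem_io ((s.smoothObj hs).smoothIO_diff ((t i).smoothObj hx)) (C.A_mem i x v)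

theorem TwoConnection.smooth_localForm (hs : x ∈ s.U) {i : ι} (hx : x ∈ (t i).U) :
    SmoothForm1At (C.localForm s) x :=
  extendForm_smooth (U := fun i => (t i).U) (fun i _ hx => (t i).smoothObj hx) C.A_eq
    (Filter.mem_of_superset (s.U.isOpen.mem_nhds hs) fun _ hy => s.smoothObj hy) hx
    (smoothForm1_iff.1 (C.A_smooth i) x hx)

/-- The two components of the local forms in different frames. -/
theorem TwoConnection.localForm_change (hs : x ∈ s.U) (hs' : x ∈ s'.U) {i : ι} (hx : x ∈ (t i).U)
    (v : TangentSpace 𝓘(ℝ, E) x) :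
    rotPart p q (C.localForm s x v) = gaugeTransform (fun y => (s.s y).change (s'.s y))
      (fun y => (s'.s y).change (s.s y)) ((rotPart p q).comp (C.localForm s' x)) v ∧
    (s.s x).toEquiv (transPart p q (C.localForm s x v)) =
      (s'.s x).toEquiv (transPart p q (C.localForm s' x v)) := by
  have h : C.localForm s x = gauge (fun y => (s.obj y).diff (s'.obj y)) (C.localForm s' x) :=
    extendForm_glue (U := fun i => (t i).U) (fun i _ hx => (t i).smoothObj hx) C.A_eq
      (s.smoothObj hs) (s'.smoothObj hs') hx
  simp_rw [LocalFrame.diff_obj] at h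
  rw [h, gauge_ofO (s.contMDiffAt_change s' hs hs')
    (ioMk_rotPart_transPart (C.localForm_mem hs' hx v)).symm, rotPart_ioMk, transPart_ioMk]
  refine ⟨?_, (s.s x).toEquiv.apply_symm_apply _⟩
  simp_rw [gaugeTransform, LocalFrame.change_eq s s']
  rfl

open Classical in
/-- The connection on the frame bundle given by a 2-connection. -/
def TwoConnection.toConnection (ht : ∀ x, ∃ i, x ∈ (t i).U) : Connection T where
  form s x := if x ∈ s.U then (rotPart p q).comp (C.localForm s x) else 0
  mem s x v := by
    split_ifs with hs
    · obtain ⟨i, hx⟩ := ht x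
      exact rotPart_mem (C.localForm_mem hs hx v)
    · exact zero_mem _
  smooth s := smoothForm1_iff.2 fun x hs => by
    obtain ⟨i, hx⟩ := ht x
    have h : SmoothForm1At (fun y => (rotPart p q).comp (C.localForm s y)) x :=
      smoothForm1At_iff.2 fun X hX => contMDiffAt_clm (rotPart p q)
        (smoothForm1At_iff.1 (C.smooth_localForm hs hx) X hX)
    refine h.congr ?_
    filter_upwards [s.U.isOpen.mem_nhds hs] with y hy
    exact if_pos hy
  zero s x hs := if_neg hs
  glue s s' x hs v := by
    obtain ⟨i, hx⟩ := ht x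
    have h₁ : x ∈ s.U := hs.1
    have h₂ : x ∈ s'.U := hs.2
    rw [if_pos h₁, if_pos h₂]
    exact (C.localForm_change hs.1 hs.2 hx v).1

theorem TwoConnection.toConnection_form (ht : ∀ x, ∃ i, x ∈ (t i).U) (hs : x ∈ s.U) :
    (C.toConnection ht).form s x = (rotPart p q).comp (C.localForm s x) := if_pos hs

/-- The translation parts in different frames represent the same vector of `V x`, so a frame may be
chosen at each point; near `x` the values can all be computed in the frame chosen at `x`, which
gives smoothness. -/
theorem TwoConnection.exists_form1 (ht : ∀ x, ∃ i, x ∈ (t i).U) :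
    ∃ e : Form1 T, ∀ (s : LocalFrame T), ∀ x ∈ s.U, ∀ v,
      e.val x v = (s.s x).toEquiv (transPart p q (C.localForm s x v)) := by
  choose s hs using LocalFrame.exists_mem ht
  have key : ∀ (s' : LocalFrame T), ∀ x ∈ s'.U, ∀ v,
      ((s x).s x).toEquiv (transPart p q (C.localForm (s x) x v)) =
        (s'.s x).toEquiv (transPart p q (C.localForm s' x v)) := fun s' x hx v => by
    obtain ⟨i, hi⟩ := ht x
    exact (C.localForm_change (hs x) hx hi v).2
  refine ⟨⟨fun x => (((s x).s x).toEquiv : Rpq p q →L[ℝ] V x).comp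
    ((transPart p q).comp (C.localForm (s x) x)), fun x => ?_⟩, key⟩
  obtain ⟨i, hi⟩ := ht x
  refine contMDiffAt_form1_iff.2 fun X hX => ((s x).contMDiffAt_section_iff (hs x)).2 ?_
  refine (contMDiffAt_clm (transPart p q)
    (smoothForm1At_iff.1 (C.smooth_localForm (hs x) hi) X hX)).congr_of_eventuallyEq ?_
  filter_upwards [(s x).U.isOpen.mem_nhds (hs x)] with y hy
  exact ((ContinuousLinearEquiv.symm_apply_eq _).2 (key (s x) y hy (X y)))

/-- By `TwoConnection.lin_B_eq` the vectors represented by the `B i` agree on overlaps, so choosing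
one trivialization at each point loses nothing. -/
theorem TwoConnection.exists_form2 (ht : ∀ x, ∃ i, x ∈ (t i).U) :
    ∃ τ : Form2 T, C.HasTwoFormPart τ := by
  choose i hi using ht
  have key : ∀ j, ∀ x ∈ (t j).U, ∀ v w, ((t (i x)).unitObj x).lin (C.B (i x) x v w) =
      ((t j).unitObj x).lin (C.B j x v w) := fun j x hx v w => C.lin_B_eq (i x) j x (hi x) hx v w
  refine ⟨⟨fun x => postcomp₂ (((t (i x)).unitObj x).lin : Rpq p q →L[ℝ] V x) (C.B (i x) x),
    fun x v => ?_, fun x => ?_⟩, TwoConnection.hasTwoFormPart_iff.2 key⟩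
  · rw [postcomp₂_apply, C.B_alt, map_zero]
  · refine contMDiffAt_form2_iff.2 fun X Y hX hY =>
      ((t (i x)).smoothObj (hi x)).contMDiffAt_section_iff.2 ?_
    refine (smoothForm2_iff.1 (C.B_smooth (i x)) x (hi x) X Y hX hY).congr_of_eventuallyEq ?_
    filter_upwards [(t (i x)).U.isOpen.mem_nhds (hi x)] with y hy
    exact (ContinuousLinearEquiv.symm_apply_eq _).2 (key (i x) y hy _ _)

/-- Moving from trivializations to frames removes the gauge transformation: what remains is an
equality of `𝔦𝔬(p,q)`-valued forms, from which `θ` and `e` are read off as components. -/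
theorem TwoConnection.hasOneFormPart_iff_localForm (ht : ∀ x, ∃ i, x ∈ (t i).U)
    {θ : Connection T} {e : Form1 T} :
    C.HasOneFormPart θ e ↔ ∀ (s : LocalFrame T), ∀ x ∈ s.U, θ.full e s x = C.localForm s x := by
  rw [TwoConnection.hasOneFormPart_iff]
  constructor
  · intro h s x hs
    obtain ⟨i, hx⟩ := ht x
    rw [C.localForm_eq hs hx]
    exact eq_gauge_diff_comm ((t i).smoothObj hx) (s.smoothObj hs) (h i s x hx hs)
  · intro h i s x hx hs
    refine eq_gauge_diff_comm (s.smoothObj hs) ((t i).smoothObj hx) ?_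
    rw [h s x hs, C.localForm_eq hs hx]

theorem TwoConnection.existsUnique_parts (ht : ∀ x, ∃ i, x ∈ (t i).U) :
    ∃! d : Connection T × Form1 T × Form2 T,
      C.HasOneFormPart d.1 d.2.1 ∧ C.HasTwoFormPart d.2.2 := by
  obtain ⟨e, he⟩ := C.exists_form1 ht
  obtain ⟨τ, hτ⟩ := C.exists_form2 ht
  have h : C.HasOneFormPart (C.toConnection ht) e := by
    refine (C.hasOneFormPart_iff_localForm ht).2 fun s x hs => ContinuousLinearMap.ext fun v => ?_
    obtain ⟨i, hx⟩ := ht x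
    rw [← ioMk_rotPart_transPart (C.localForm_mem hs hx v), Connection.full_apply, ioMk_inj]
    refine ⟨?_, (ContinuousLinearEquiv.symm_apply_eq _).2 (he s x hs v)⟩
    rw [C.toConnection_form ht hs]
    rfl
  refine ⟨(C.toConnection ht, e, τ), ⟨h, hτ⟩, ?_⟩
  rintro ⟨θ', e', τ'⟩ ⟨h', hτ'⟩
  dsimp only at h' hτ'
  -- Both pairs have the same local form in every frame, and `ioMk` is injective.
  have key : ∀ (s : LocalFrame T), ∀ x ∈ s.U, ∀ v,
      θ'.form s x v = (C.toConnection ht).form s x v ∧ e'.coform s x v = e.coform s x v := by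
    intro s x hs v
    have h1 := (C.hasOneFormPart_iff_localForm ht).1 h s x hs
    rw [← (C.hasOneFormPart_iff_localForm ht).1 h' s x hs] at h1
    exact ioMk_inj.1 (DFunLike.congr_fun h1 v).symm
  refine Prod.ext ?_ (Prod.ext ?_ ?_)
  · refine Connection.ext (funext fun s => funext fun x => ContinuousLinearMap.ext fun v => ?_)
    by_cases hs : x ∈ s.U
    · exact (key s x hs v).1
    · rw [θ'.zero s x hs, (C.toConnection ht).zero s x hs]
  · refine Form1.ext (funext fun x => ContinuousLinearMap.ext fun v => ?_)
    obtain ⟨s, hs⟩ := LocalFrame.exists_mem ht x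
    exact (s.s x).toEquiv.symm.injective (key s x hs v).2
  · refine Form2.ext (funext fun x => ContinuousLinearMap.ext fun v =>
      ContinuousLinearMap.ext fun w => ?_)
    obtain ⟨i, hx⟩ := ht x
    exact (TwoConnection.hasTwoFormPart_iff.1 hτ' i x hx v w).trans
      (TwoConnection.hasTwoFormPart_iff.1 hτ i x hx v w).symm

end Decomposition

end TwoConnections

end Teleparallel

end

theorem mainTheorem2 (p q : ℕ)
    {E : Type*} [NormedAddCommGroup E] [NormedSpace ℝ E] [FiniteDimensional ℝ E]
    {M : Type*} [TopologicalSpace M] [T2Space M] [SecondCountableTopology M]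
    [ChartedSpace E M] [IsManifold 𝓘(ℝ, E) ∞ M]
    {F : Type*} [NormedAddCommGroup F] [NormedSpace ℝ F] [FiniteDimensional ℝ F]
    {V : M → Type*} [TopologicalSpace (TotalSpace F V)]
    [∀ x, AddCommGroup (V x)] [∀ x, Module ℝ (V x)] [∀ x, TopologicalSpace (V x)]
    [∀ x, IsTopologicalAddGroup (V x)] [∀ x, ContinuousSMul ℝ (V x)]
    [FiberBundle F V] [VectorBundle ℝ F V] [ContMDiffVectorBundle ∞ F V 𝓘(ℝ, E)]
    (T : Teleparallel.FakeTangentBundle (E := E) p q F V)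
    {ι : Type*} (t : ι → Teleparallel.LocalTriv T) (ht : ∀ x, ∃ i, x ∈ (t i).U) :
    -- the torsion, i.e. the covariant exterior derivative of `e`, is a well-defined 2-form
    (∀ (θ : Teleparallel.Connection T) (e : Teleparallel.Form1 T),
      ∃! τ : Teleparallel.Form2 T, Teleparallel.IsTorsion θ e τ) ∧
    -- every 2-connection decomposes uniquely
    (∀ C : Teleparallel.TwoConnection t,
      ∃! d : Teleparallel.Connection T × Teleparallel.Form1 T × Teleparallel.Form2 T,
        C.HasOneFormPart d.1 d.2.1 ∧ C.HasTwoFormPart d.2.2) ∧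
    -- the connection is then flat, and the 2-form part is the torsion
    (∀ (C : Teleparallel.TwoConnection t) (θ : Teleparallel.Connection T)
      (e : Teleparallel.Form1 T) (τ : Teleparallel.Form2 T),
      C.HasOneFormPart θ e → C.HasTwoFormPart τ →
        θ.IsFlat ∧ Teleparallel.IsTorsion θ e τ) ∧
    -- conversely, all such data arise, each from exactly one 2-connection
    (∀ (θ : Teleparallel.Connection T) (e : Teleparallel.Form1 T) (τ : Teleparallel.Form2 T),
      θ.IsFlat → Teleparallel.IsTorsion θ e τ →
        ∃! C : Teleparallel.TwoConnection t, C.HasOneFormPart θ e ∧ C.HasTwoFormPart τ) := by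
  exact ⟨fun θ e => Teleparallel.existsUnique_torsion θ e (Teleparallel.LocalFrame.exists_mem ht),
    fun C => C.existsUnique_parts ht,
    fun C θ e τ h₁ h₂ => C.flat_and_isTorsion ht h₁ h₂,
    fun θ e τ hθ hτ => Teleparallel.TwoConnection.existsUnique_of_isTorsion ht hθ hτ⟩
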